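/- For a cubic polynomial $P(x)=a_3x^3+a_2x^2+a_1x+a_0$ with integer coefficients, $a_3\neq 0$, let $H(P)=\max_{0\le i\le 3}|a_i|$ be its height, $D(P)$ its discriminant, and $r(P)$ the largest distance between two of its complex roots. For every $\epsilon>0$ there exists a constant $c=c(\epsilon)>0$ such that for all real $H\ge 1$, $D>0$ and $R>0$, the number $N(H,D,R)$ of cubic polynomials $P\in\mathbb{Z}[x]$ whose leading coefficient has the largest absolute value among all coefficients, i.e. $|a_3|=H(P)$, and which satisfy $$H(P)\le H,\qquad 0<|D(P)|\le D,\qquad r(P)\ge R^{-1},$$ is finite and bounded from above by $$N(H,D,R)\le c\left(\min\left\{H^{2/3+\epsilon}D^{5/6},\ \log H\cdot DR\right\}+H^{\epsilon}D\right).$$ -/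

import Mathlib

open Polynomial

/-- The root spread `r(P)`: the largest distance between two complex roots of `P`. For `P ≠ 0` the
set of roots is finite, so its diameter is attained. -/
noncomputable def rootSpread (P : ℤ[X]) : ℝ :=
  Metric.diam (P.rootSet ℂ)

/-- The integer polynomials `P` of degree exactly three with `|a₃| = H(P) ≤ H`, `0 < |D(P)| ≤ D`
and `r(P) ≥ R⁻¹`, where `H(P)` is the naive height (the largest absolute value of a
coefficient), `a₃` the leading coefficient and `D(P)` the discriminant. -/
def cubicsOfBoundedDiscr (H D R : ℝ) : Set ℤ[X] :=
  {P | P.natDegree = 3 ∧ |(P.leadingCoeff : ℝ)| = P.supNorm ∧ P.supNorm ≤ H ∧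
    0 < |(P.discr : ℝ)| ∧ |(P.discr : ℝ)| ≤ D ∧ R⁻¹ ≤ rootSpread P}

/-!
A cubic `P` is read as a binary cubic form and `SL₂(ℤ)` acts on it by substitution. If `P = G ∘ γ`
and the leading coefficient of `P` dominates its other coefficients, then `P` is determined by `G` and
the first column `v` of `γ`, a primitive vector (`Cubic.IsFactorization.finite_and_ncard_le`). So the
number of `P` is at most the number of reduced forms `G` times the number of admissible `v` for
each `G`.

*The vectors `v`.* Write `s G = L₁ L₂ L₃` with linear forms of sum zero and pairwise determinants
`s`, so that `|s| = √|D(G)|` (`Cubic.IsFactorization`). The leading coefficient of `P` is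
`L₁(v) L₂(v) L₃(v) / s`, and the distances between its roots are `|L_k(v)| / |a₃|`. As the sum of the
`L_i` is zero, the two largest values are comparable; if `Y` is the largest one, the smallest is at
most `V / Y`, where both `V = 2 |s| R` and `V = (2 |s| H)^(2/3)` are allowed
(`Cubic.IsFactorization.exists_small`). For `Y` in a dyadic interval `v` lies in a parallelogram of
area `O(V / |s|)`, and a parallelogram of area `A` contains `O(1 + A)` primitive vectors, whatever
its shape (`finite_and_ncard_le_of_wedge_le`). There are `O(1 + log H)` dyadic intervals, because the
roots of `P` are at most `2` in absolute value, which gives `Y ≤ 4 H`.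

*The forms `G`.* In every class there is a form at whose first basis vector all linear factors are
`O(√|s|)`, so that its leading coefficient `a` is `O(D^(1/4))` and that of its Hessian,
`h = b² - 3 a c`, is `O(D^(1/2))` (`Cubic.IsDominated.exists_equivalent`). After a translation
`0 ≤ b < 3 |a|`. For given `a, b, c` the syzygy `T² = 4 h³ - 27 a² D(G)` confines the last
coefficient to two intervals, of length both `O(D / |h|^(3/2))` and `O(D^(1/2) / |a|)`; summing over
`c`, `b` and `a` gives `O(D)` forms. The forms with `a = 0` are counted directly
(`Cubic.finite_reducedForms_and_ncard_le`).

The choice `V = 2 |s| R` gives the bound `O(D R log H)`. With the other choice each `G` contributes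
`O((1 + log H) (1 + H^(2/3) |D(G)|^(-1/6)))`, which is summed over the ranges
`D / 64 < |D(G)| ≤ D` (`Cubic.finite_and_ncard_le_of_discr_le`).
-/

/-! ### Counting by fibres, and lattice points in the plane -/

/-- A set that maps into a finite set `T` with finite fibres is finite, and its size is at most the
sum of any bounds on the sizes of the fibres. -/
lemma finite_and_ncard_le_sum_of_fibers {α β : Type*} (S : Set α) (f : α → β) (T : Finset β)
    (g : β → ℝ) (hf : ∀ x ∈ S, f x ∈ T)
    (hg : ∀ t ∈ T, {x ∈ S | f x = t}.Finite ∧ ({x ∈ S | f x = t}.ncard : ℝ) ≤ g t) :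
    S.Finite ∧ (S.ncard : ℝ) ≤ ∑ t ∈ T, g t := by
  classical
  have hS : S = ⋃ t ∈ T, {x ∈ S | f x = t} := by
    ext x
    simp only [Set.mem_iUnion, Set.mem_ofPred_eq, exists_prop]
    exact ⟨fun hx => ⟨f x, hf x hx, hx, rfl⟩, fun ⟨_, _, hx, _⟩ => hx⟩
  have hfin : S.Finite := by
    rw [hS]
    exact Set.Finite.biUnion T.finite_toSet fun t ht => (hg t ht).1
  refine ⟨hfin, ?_⟩
  have hcard : S.ncard = ∑ t ∈ T, {x ∈ S | f x = t}.ncard := by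
    rw [Set.ncard_eq_toFinset_card S hfin,
      Finset.card_eq_sum_card_fiberwise (f := f) (t := T) (by intro x hx; exact hf x (by simpa using hx))]
    refine Finset.sum_congr rfl fun t ht => ?_
    rw [Set.ncard_eq_toFinset_card _ (hg t ht).1]
    congr 1
    ext x
    simp
  rw [hcard]
  push_cast
  exact Finset.sum_le_sum fun t ht => (hg t ht).2

/-- If an injective integer-valued map has oscillation at most `ℓ` on `S`, then `S` has at most
`ℓ + 1` elements. -/
lemma finite_and_ncard_le_of_abs_sub_le {α : Type*} (S : Set α) (f : α → ℤ) (hf : Set.InjOn f S)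
    (ℓ : ℝ) (hℓ : 0 ≤ ℓ) (h : ∀ x ∈ S, ∀ y ∈ S, |(f x : ℝ) - f y| ≤ ℓ) :
    S.Finite ∧ (S.ncard : ℝ) ≤ ℓ + 1 := by
  rcases S.eq_empty_or_nonempty with rfl | ⟨x₀, hx₀⟩
  · simp; positivity
  have hd : ∀ x ∈ S, ∀ y ∈ S, |f x - f y| ≤ ⌊ℓ⌋ := fun x hx y hy => by
    rw [Int.le_floor]; push_cast; exact h x hx y hy
  have hfin : (f '' S).Finite := by
    refine (Set.finite_Icc (f x₀ - ⌊ℓ⌋) (f x₀ + ⌊ℓ⌋)).subset ?_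
    rintro _ ⟨x, hx, rfl⟩
    have := abs_le.1 (hd x hx x₀ hx₀)
    exact ⟨by linarith, by linarith⟩
  obtain ⟨m, ⟨xm, hxm, rfl⟩, hmin⟩ := Set.exists_min_image (f '' S) id hfin ⟨_, x₀, hx₀, rfl⟩
  have hsub : f '' S ⊆ (Finset.Icc (f xm) (f xm + ⌊ℓ⌋) : Finset ℤ) := by
    rintro _ ⟨x, hx, rfl⟩
    have h1 := (abs_le.1 (hd x hx xm hxm)).2
    have h2 := hmin (f x) ⟨x, hx, rfl⟩
    simp only [id] at h2
    simp only [Finset.coe_Icc, Set.mem_Icc]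
    exact ⟨h2, by linarith⟩
  refine ⟨Set.Finite.of_finite_image hfin hf, ?_⟩
  have h3 := Set.ncard_le_ncard hsub (Finset.finite_toSet _)
  rw [hf.ncard_image, Set.ncard_coe_finset, Int.card_Icc] at h3
  have h4 : (0 : ℤ) ≤ ⌊ℓ⌋ := Int.floor_nonneg.2 hℓ
  have h5 : (S.ncard : ℤ) ≤ ⌊ℓ⌋ + 1 := by omega
  have h6 : ((S.ncard : ℤ) : ℝ) ≤ ((⌊ℓ⌋ + 1 : ℤ) : ℝ) := by exact_mod_cast h5
  push_cast at h6
  linarith [Int.floor_le ℓ]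

/-- The determinant of two integer vectors. -/
def wedge (v w : ℤ × ℤ) : ℤ := v.1 * w.2 - v.2 * w.1

/-- Integer vectors with the same determinant against a primitive vector `v` differ by a multiple of
`v`. -/
lemma exists_add_mul_of_wedge_eq {v w w' : ℤ × ℤ} (hv : IsCoprime v.1 v.2)
    (h : wedge v w = wedge v w') : ∃ t : ℤ, w' = (w.1 + t * v.1, w.2 + t * v.2) := by
  obtain ⟨x, y, hxy⟩ := hv
  unfold wedge at h
  refine ⟨x * (w'.1 - w.1) + y * (w'.2 - w.2), Prod.ext ?_ ?_⟩ <;> simp only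
  · linear_combination (w.1 - w'.1) * hxy + y * h
  · linear_combination (w.2 - w'.2) * hxy - x * h

/-- A set of primitive integer vectors whose pairwise determinants are at most `m` in absolute value
has at most `2 + 9 m` elements. In particular a symmetric convex region of area `A` contains
`O(A + 1)` primitive vectors, however elongated it is. -/
lemma finite_and_ncard_le_of_wedge_le (S : Set (ℤ × ℤ)) (hS : ∀ v ∈ S, IsCoprime v.1 v.2) (m : ℕ)
    (h : ∀ v ∈ S, ∀ w ∈ S, (wedge v w).natAbs ≤ m) : S.Finite ∧ S.ncard ≤ 2 + 9 * m := by
  classical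
  rcases S.eq_empty_or_nonempty with rfl | ⟨v₀, hv₀⟩
  · simp
  -- The largest determinant `k` occurring in `S`.
  set k := Nat.findGreatest (fun k => ∃ v ∈ S, ∃ w ∈ S, (wedge v w).natAbs = k) m with hk
  have hkm : k ≤ m := Nat.findGreatest_le m
  have hmax : ∀ v ∈ S, ∀ w ∈ S, (wedge v w).natAbs ≤ k := fun v hv w hw =>
    Nat.le_findGreatest (h v hv w hw) ⟨v, hv, w, hw, rfl⟩
  obtain ⟨v, hv, w, hw, hvw⟩ : ∃ v ∈ S, ∃ w ∈ S, (wedge v w).natAbs = k :=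
    Nat.findGreatest_spec (P := fun k => ∃ v ∈ S, ∃ w ∈ S, (wedge v w).natAbs = k) (Nat.zero_le m)
      ⟨v₀, hv₀, v₀, hv₀, by simp [wedge, mul_comm]⟩
  rcases Nat.eq_zero_or_pos k with hk0 | hkpos
  · -- All vectors of `S` are proportional to `v₀`, hence equal to `±v₀`.
    have hsub : S ⊆ (({v₀, (-v₀.1, -v₀.2)} : Finset (ℤ × ℤ)) : Set (ℤ × ℤ)) := by
      intro u hu
      have h0 : wedge v₀ 0 = wedge v₀ u := by
        have := hmax v₀ hv₀ u hu
        rw [hk0] at this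
        simp only [Nat.le_zero, Int.natAbs_eq_zero] at this
        rw [this]; simp [wedge]
      obtain ⟨t, ht⟩ := exists_add_mul_of_wedge_eq (hS v₀ hv₀) h0
      simp only [Prod.fst_zero, Prod.snd_zero, zero_add] at ht
      have hcop := hS u hu
      rw [ht] at hcop
      have htu : IsUnit t := hcop.isUnit_of_dvd' (dvd_mul_right _ _) (dvd_mul_right _ _)
      rcases Int.isUnit_iff.1 htu with rfl | rfl <;> simp [ht]
    refine ⟨(Finset.finite_toSet _).subset hsub, ?_⟩
    have h3 := Set.ncard_le_ncard hsub (Finset.finite_toSet _)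
    rw [Set.ncard_coe_finset] at h3
    have := Finset.card_le_two (a := v₀) (b := (-v₀.1, -v₀.2))
    omega
  · -- Given the determinant against `v`, that against `w` is determined modulo `k`.
    set K : ℤ := wedge v w with hK
    have hKk : |K| = k := by rw [Int.abs_eq_natAbs, hvw]
    have hmaps : Set.MapsTo (fun u => (wedge v u, wedge u w / k)) S
        ((Finset.Icc (-k : ℤ) k ×ˢ Finset.Icc (-1 : ℤ) 1 : Finset (ℤ × ℤ)) : Set (ℤ × ℤ)) := by
      intro u hu
      have h1 := hmax v hv u hu
      have h2 := hmax u hu w hw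
      have hkz : (0 : ℤ) < k := by exact_mod_cast hkpos
      simp only [Finset.coe_product, Finset.coe_Icc, Set.mem_prod, Set.mem_Icc]
      refine ⟨⟨by omega, by omega⟩, ?_, ?_⟩
      · rw [Int.le_ediv_iff_mul_le hkz]; omega
      · apply Int.le_of_lt_add_one
        rw [Int.ediv_lt_iff_lt_mul hkz]; omega
    have hinj : Set.InjOn (fun u => (wedge v u, wedge u w / k)) S := by
      intro u _ u' _ huu
      simp only [Prod.mk.injEq] at huu
      obtain ⟨t, ht⟩ := exists_add_mul_of_wedge_eq (hS v hv) huu.1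
      have hkz : (0 : ℤ) < k := by exact_mod_cast hkpos
      have h1 : wedge u' w = wedge u w + t * K := by
        rw [ht, hK]; simp only [wedge]; ring
      have ht0 : t = 0 := by
        rcases abs_eq hkz.le |>.1 hKk with h | h <;> rw [h1, h] at huu
        · rw [Int.add_mul_ediv_right _ _ hkz.ne'] at huu; omega
        · rw [show wedge u w + t * -(k : ℤ) = wedge u w + (-t) * k by ring,
            Int.add_mul_ediv_right _ _ hkz.ne'] at huu; omega
      rw [ht, ht0]; simp
    refine ⟨Set.Finite.of_finite_image ((Finset.finite_toSet _).subset hmaps.image_subset) hinj, ?_⟩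
    have h3 := Set.ncard_le_ncard_of_injOn _ hmaps hinj (Finset.finite_toSet _)
    rw [Set.ncard_coe_finset, Finset.card_product, Int.card_Icc, Int.card_Icc] at h3
    have e1 : ((k : ℤ) + 1 - -k).toNat = 2 * k + 1 := by omega
    have e2 : ((1 : ℤ) + 1 - -1).toNat = 3 := rfl
    rw [e1, e2] at h3
    omega

/-! ### Binary cubic forms and their linear factors -/

namespace Cubic

/-- The coefficients of the binary cubic form `F(p X + q Y, r X + s Y)`, where `F` is read as the
form `a X³ + b X² Y + c X Y² + d Y³`. -/
def subst (F : Cubic ℤ) (p q r s : ℤ) : Cubic ℤ where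
  a := F.a * p ^ 3 + F.b * p ^ 2 * r + F.c * p * r ^ 2 + F.d * r ^ 3
  b := 3 * F.a * p ^ 2 * q + F.b * (p ^ 2 * s + 2 * p * q * r) + F.c * (2 * p * r * s + q * r ^ 2)
    + 3 * F.d * r ^ 2 * s
  c := 3 * F.a * p * q ^ 2 + F.b * (2 * p * q * s + q ^ 2 * r) + F.c * (p * s ^ 2 + 2 * q * r * s)
    + 3 * F.d * r * s ^ 2
  d := F.a * q ^ 3 + F.b * q ^ 2 * s + F.c * q * s ^ 2 + F.d * s ^ 3

lemma subst_subst (F : Cubic ℤ) (p q r s p' q' r' s' : ℤ) :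
    (F.subst p q r s).subst p' q' r' s' =
      F.subst (p * p' + q * r') (p * q' + q * s') (r * p' + s * r') (r * q' + s * s') := by
  simp only [subst, Cubic.mk.injEq]
  refine ⟨?_, ?_, ?_, ?_⟩ <;> ring

lemma subst_id (F : Cubic ℤ) : F.subst 1 0 0 1 = F := by
  cases F; simp [subst]

lemma discr_subst (F : Cubic ℤ) {p q r s : ℤ} (h : p * s - q * r = 1) :
    (F.subst p q r s).discr = F.discr := by
  have : (F.subst p q r s).discr = (p * s - q * r) ^ 6 * F.discr := by
    simp only [subst, discr]; ring
  rw [this, h]; ring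

/-- `F` and `G` are properly equivalent: they differ by a substitution in `SL₂(ℤ)`. -/
def Equivalent (F G : Cubic ℤ) : Prop :=
  ∃ p q r s : ℤ, p * s - q * r = 1 ∧ G = F.subst p q r s

lemma Equivalent.symm {F G : Cubic ℤ} (h : F.Equivalent G) : G.Equivalent F := by
  obtain ⟨p, q, r, s, h, rfl⟩ := h
  refine ⟨s, -q, -r, p, by linarith, ?_⟩
  rw [subst_subst, show p * s + q * -r = 1 by linarith, show p * -q + q * p = 0 by ring,
    show r * s + s * -r = 0 by ring, show r * -q + s * p = 1 by linarith, subst_id]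

lemma Equivalent.trans {F G K : Cubic ℤ} (h : F.Equivalent G) (h' : G.Equivalent K) :
    F.Equivalent K := by
  obtain ⟨p, q, r, s, h, rfl⟩ := h
  obtain ⟨p', q', r', s', h', rfl⟩ := h'
  refine ⟨_, _, _, _, ?_, subst_subst F p q r s p' q' r' s'⟩
  linear_combination h' * (p * s - q * r) + h

lemma Equivalent.discr_eq {F G : Cubic ℤ} (h : F.Equivalent G) : G.discr = F.discr := by
  obtain ⟨p, q, r, s, h, rfl⟩ := h
  exact discr_subst F h

/-- Normalised linear factors of a binary cubic form `F` of non-zero discriminant: with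
`L₁ = α₁ X + β₁ Y`, `L₂ = α₂ X + β₂ Y` and `L₃ = -(L₁ + L₂)`, any two consecutive factors have
determinant `s = α₁ β₂ - α₂ β₁`, and `L₁ L₂ L₃ = s F`. For `a ≠ 0` one such triple is
`L_i = a (x_j - x_k) (X - x_i Y)`, where `x₁, x₂, x₃` are the roots of `F(X, 1)` and `(i, j, k)` runs
over the cyclic permutations of the indices. -/
structure IsFactorization (F : Cubic ℤ) (α₁ β₁ α₂ β₂ s : ℂ) : Prop where
  det : s = α₁ * β₂ - α₂ * β₁
  a : s * F.a = -(α₁ * α₂ * (α₁ + α₂))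
  b : s * F.b = -(α₁ * α₂ * (β₁ + β₂) + (α₁ * β₂ + β₁ * α₂) * (α₁ + α₂))
  c : s * F.c = -(β₁ * β₂ * (α₁ + α₂) + (α₁ * β₂ + β₁ * α₂) * (β₁ + β₂))
  d : s * F.d = -(β₁ * β₂ * (β₁ + β₂))
  ne_zero : s ≠ 0

variable {F : Cubic ℤ} {α₁ β₁ α₂ β₂ s : ℂ}

lemma IsFactorization.sq_eq (h : F.IsFactorization α₁ β₁ α₂ β₂ s) : s ^ 2 = (F.discr : ℂ) := by
  refine mul_left_cancel₀ (pow_ne_zero 4 h.ne_zero) ?_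
  have : s ^ 4 * (F.discr : ℂ) = (s * F.b) ^ 2 * (s * F.c) ^ 2 - 4 * (s * F.a) * (s * F.c) ^ 3
      - 4 * (s * F.b) ^ 3 * (s * F.d) - 27 * (s * F.a) ^ 2 * (s * F.d) ^ 2
      + 18 * (s * F.a) * (s * F.b) * (s * F.c) * (s * F.d) := by
    simp only [discr]; push_cast; ring
  rw [this, h.a, h.b, h.c, h.d, h.det]
  ring

/-- The leading coefficient of the Hessian is a quadratic form in the linear factors. -/
lemma IsFactorization.hessian_eq (h : F.IsFactorization α₁ β₁ α₂ β₂ s) :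
    (F.b : ℂ) ^ 2 - 3 * F.a * F.c = α₁ ^ 2 + α₁ * α₂ + α₂ ^ 2 := by
  refine mul_left_cancel₀ (pow_ne_zero 2 h.ne_zero) ?_
  have : s ^ 2 * ((F.b : ℂ) ^ 2 - 3 * F.a * F.c) = (s * F.b) ^ 2 - 3 * (s * F.a) * (s * F.c) := by
    ring
  rw [this, h.a, h.b, h.c, h.det]
  ring

lemma IsFactorization.subst (h : F.IsFactorization α₁ β₁ α₂ β₂ s) {p q r t : ℤ}
    (hdet : p * t - q * r = 1) :
    (F.subst p q r t).IsFactorization (p * α₁ + r * β₁) (q * α₁ + t * β₁)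
      (p * α₂ + r * β₂) (q * α₂ + t * β₂) s := by
  have hdet' : (p : ℂ) * t - q * r = 1 := by exact_mod_cast hdet
  refine ⟨?_, ?_, ?_, ?_, ?_, h.ne_zero⟩
  · rw [h.det]; linear_combination (α₂ * β₁ - α₁ * β₂) * hdet'
  all_goals
    simp only [Cubic.subst]; push_cast
  · linear_combination p ^ 3 * h.a + p ^ 2 * r * h.b + p * r ^ 2 * h.c + r ^ 3 * h.d
  · linear_combination 3 * p ^ 2 * q * h.a + (p ^ 2 * t + 2 * p * q * r) * h.b
      + (2 * p * r * t + q * r ^ 2) * h.c + 3 * r ^ 2 * t * h.d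
  · linear_combination 3 * p * q ^ 2 * h.a + (2 * p * q * t + q ^ 2 * r) * h.b
      + (p * t ^ 2 + 2 * q * r * t) * h.c + 3 * r * t ^ 2 * h.d
  · linear_combination q ^ 3 * h.a + q ^ 2 * t * h.b + q * t ^ 2 * h.c + t ^ 3 * h.d

/-- The factorisation of a cubic with known roots. -/
lemma isFactorization_of_roots {x₁ x₂ x₃ : ℂ} (hb : (F.b : ℂ) = -F.a * (x₁ + x₂ + x₃))
    (hc : (F.c : ℂ) = F.a * (x₁ * x₂ + x₁ * x₃ + x₂ * x₃)) (hd : (F.d : ℂ) = -F.a * (x₁ * x₂ * x₃))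
    (h0 : F.discr ≠ 0) :
    F.IsFactorization (F.a * (x₃ - x₁)) (-x₂ * (F.a * (x₃ - x₁))) (F.a * (x₁ - x₂))
      (-x₃ * (F.a * (x₁ - x₂))) (F.a ^ 2 * ((x₃ - x₁) * (x₁ - x₂) * (x₂ - x₃))) := by
  have hs : ((F.a : ℂ) ^ 2 * ((x₃ - x₁) * (x₁ - x₂) * (x₂ - x₃))) ^ 2 = (F.discr : ℂ) := by
    simp only [discr]; push_cast; rw [hb, hc, hd]; ring
  refine ⟨by ring, by ring, by rw [hb]; ring, by rw [hc]; ring, by rw [hd]; ring, fun h => ?_⟩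
  rw [h] at hs
  refine h0 ?_
  have : (F.discr : ℂ) = 0 := by rw [← hs]; ring
  exact_mod_cast this

lemma IsFactorization.norm_sq (h : F.IsFactorization α₁ β₁ α₂ β₂ s) :
    ‖s‖ ^ 2 = |(F.discr : ℝ)| := by
  rw [← norm_pow, h.sq_eq, Complex.norm_intCast]

lemma IsFactorization.one_le_norm (h : F.IsFactorization α₁ β₁ α₂ β₂ s) : 1 ≤ ‖s‖ := by
  have h0 : F.discr ≠ 0 := fun h0 => h.ne_zero <| by
    have := h.sq_eq
    rw [h0] at this
    simpa using this
  have h1 := h.norm_sq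
  have h2 : (1 : ℝ) ≤ |(F.discr : ℝ)| := by exact_mod_cast Int.one_le_abs h0
  nlinarith [norm_nonneg s]

end Cubic

/-! ### Primitive vectors at which one linear factor is small -/

/-- Primitive vectors at which two linear forms of determinant `s` are at most `w` and `X`. -/
lemma finite_and_ncard_le_of_norm_le (S : Set (ℤ × ℤ)) (hS : ∀ v ∈ S, IsCoprime v.1 v.2)
    (L M : ℤ × ℤ → ℂ) (s : ℂ) (hs : s ≠ 0)
    (hLM : ∀ v w, s * wedge v w = L v * M w - L w * M v) (w X : ℝ)
    (hw : 0 ≤ w) (hX : 0 ≤ X) (hL : ∀ v ∈ S, ‖L v‖ ≤ w) (hM : ∀ v ∈ S, ‖M v‖ ≤ X) :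
    S.Finite ∧ (S.ncard : ℝ) ≤ 2 + 18 * (w * X / ‖s‖) := by
  have hs' : 0 < ‖s‖ := norm_pos_iff.2 hs
  have hm : 0 ≤ 2 * (w * X) / ‖s‖ := by positivity
  obtain ⟨h1, h2⟩ := finite_and_ncard_le_of_wedge_le S hS ⌊2 * (w * X) / ‖s‖⌋₊ (by
    intro u hu v hv
    rw [Nat.le_floor_iff hm, le_div_iff₀ hs']
    have h3 : ‖s * wedge u v‖ ≤ w * X + w * X := by
      rw [hLM]
      refine (norm_sub_le _ _).trans ?_
      rw [norm_mul, norm_mul]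
      exact add_le_add (mul_le_mul (hL u hu) (hM v hv) (norm_nonneg _) hw)
        (mul_le_mul (hL v hv) (hM u hu) (norm_nonneg _) hw)
    rw [norm_mul, Complex.norm_intCast] at h3
    rw [Nat.cast_natAbs, Int.cast_abs]
    linarith)
  refine ⟨h1, ?_⟩
  have h3 : (S.ncard : ℝ) ≤ 2 + 9 * (⌊2 * (w * X) / ‖s‖⌋₊ : ℝ) := by exact_mod_cast h2
  have h4 := Nat.floor_le hm
  have h5 : 2 * (w * X) / ‖s‖ = 2 * (w * X / ‖s‖) := by ring
  linarith

/-- Primitive vectors `v` at which three linear forms `L_i` with pairwise determinants `s` are all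
at most `Y(v) ∈ [1, Z]`, one of them being at most `V / Y(v)`. Vectors with `Y(v) ∈ [2^j, 2^(j+1))`
lie in three parallelograms of area `O(V / |s|)`, and there are `O(1 + log Z)` values of `j`. -/
lemma finite_and_ncard_le_of_mul_le (S : Set (ℤ × ℤ)) (hS : ∀ v ∈ S, IsCoprime v.1 v.2)
    (L : Fin 3 → ℤ × ℤ → ℂ) (s : ℂ) (hs : s ≠ 0)
    (hL : ∀ i v w, s * wedge v w = L i v * L (i + 1) w - L i w * L (i + 1) v)
    (V Z : ℝ) (hV : 0 ≤ V) (hZ : 1 ≤ Z)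
    (h : ∀ v ∈ S, ∃ Y, 1 ≤ Y ∧ Y ≤ Z ∧ (∀ i, ‖L i v‖ ≤ Y) ∧ ∃ i, ‖L i v‖ * Y ≤ V) :
    S.Finite ∧ (S.ncard : ℝ) ≤ 3 * (Real.logb 2 Z + 1) * (2 + 36 * (V / ‖s‖)) := by
  classical
  choose! Y hY1 hYZ hYL i hi using h
  have hs' : 0 < ‖s‖ := norm_pos_iff.2 hs
  have hpow : ∀ v ∈ S, (2 : ℝ) ^ Nat.log 2 ⌊Y v⌋₊ ≤ Y v ∧ Y v < 2 ^ (Nat.log 2 ⌊Y v⌋₊ + 1) := by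
    intro v hv
    have h1 : 1 ≤ ⌊Y v⌋₊ := Nat.one_le_floor_iff _ |>.2 (hY1 v hv)
    have h2 := Nat.pow_log_le_self 2 (Nat.one_le_iff_ne_zero.1 h1)
    have h3 := Nat.lt_pow_succ_log_self (b := 2) (by norm_num) ⌊Y v⌋₊
    constructor
    · refine le_trans ?_ (Nat.floor_le (by linarith [hY1 v hv]))
      exact_mod_cast h2
    · have := (Nat.floor_lt' (a := Y v) (n := 2 ^ (Nat.log 2 ⌊Y v⌋₊ + 1)) (by positivity)).1 h3
      exact_mod_cast this
  obtain ⟨h1, h2⟩ := finite_and_ncard_le_sum_of_fibers S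
    (fun v => (Nat.log 2 ⌊Y v⌋₊, i v))
    (Finset.range (Nat.log 2 ⌊Z⌋₊ + 1) ×ˢ Finset.univ) (fun _ => 2 + 36 * (V / ‖s‖))
    (by
      intro v hv
      simp only [Finset.mem_product, Finset.mem_range, Finset.mem_univ, and_true]
      exact Nat.lt_succ_of_le (Nat.log_mono_right (Nat.floor_mono (hYZ v hv))))
    (by
      rintro ⟨j, k⟩ _
      have h3 := finite_and_ncard_le_of_norm_le {v ∈ S | (Nat.log 2 ⌊Y v⌋₊, i v) = (j, k)}
        (fun v hv => hS v hv.1) (L k) (L (k + 1)) s hs (hL k) (V / 2 ^ j) (2 ^ (j + 1))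
        (by positivity) (by positivity)
        (by
          rintro v ⟨hv, hjk⟩
          simp only [Prod.mk.injEq] at hjk
          obtain ⟨rfl, rfl⟩ := hjk
          rw [le_div_iff₀ (by positivity)]
          exact (mul_le_mul_of_nonneg_left (hpow v hv).1 (norm_nonneg _)).trans (hi v hv))
        (by
          rintro v ⟨hv, hjk⟩
          simp only [Prod.mk.injEq] at hjk
          obtain ⟨rfl, rfl⟩ := hjk
          exact (hYL v hv _).trans (hpow v hv).2.le)
      refine ⟨h3.1, h3.2.trans (le_of_eq ?_)⟩
      rw [pow_succ]
      field_simp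
      ring)
  refine ⟨h1, h2.trans ?_⟩
  rw [Finset.sum_const, Finset.card_product, Finset.card_range, Finset.card_univ, Fintype.card_fin,
    nsmul_eq_mul]
  refine mul_le_mul_of_nonneg_right ?_ (by positivity)
  have h3 : (Nat.log 2 ⌊Z⌋₊ : ℝ) ≤ Real.logb 2 Z := by
    rw [Real.le_logb_iff_rpow_le (by norm_num) (by linarith), Real.rpow_natCast]
    refine le_trans ?_ (Nat.floor_le (by linarith))
    have := Nat.pow_log_le_self 2 (x := ⌊Z⌋₊)
      (Nat.one_le_iff_ne_zero.1 ((Nat.one_le_floor_iff _).2 hZ))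
    exact_mod_cast this
  push_cast
  linarith

/-! ### Roots, root spread and linear factors -/

/-- A root of a polynomial whose leading coefficient dominates has absolute value at most `2`. -/
lemma norm_root_le_two {a b c d z : ℂ} (ha : a ≠ 0) (hb : ‖b‖ ≤ ‖a‖) (hc : ‖c‖ ≤ ‖a‖)
    (hd : ‖d‖ ≤ ‖a‖) (hz : a * z ^ 3 + b * z ^ 2 + c * z + d = 0) : ‖z‖ ≤ 2 := by
  by_contra! h
  have ha' : 0 < ‖a‖ := norm_pos_iff.2 ha
  have h1 : ‖a‖ * ‖z‖ ^ 3 ≤ ‖a‖ * ‖z‖ ^ 2 + ‖a‖ * ‖z‖ + ‖a‖ := by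
    calc ‖a‖ * ‖z‖ ^ 3 = ‖b * z ^ 2 + c * z + d‖ := by
          rw [← norm_pow, ← norm_mul, show a * z ^ 3 = -(b * z ^ 2 + c * z + d) by
            linear_combination hz, norm_neg]
      _ ≤ ‖b‖ * ‖z‖ ^ 2 + ‖c‖ * ‖z‖ + ‖d‖ := by
          refine (norm_add₃_le).trans (le_of_eq ?_)
          simp only [norm_mul, norm_pow]
      _ ≤ _ := by gcongr
  have h2 : ‖z‖ ^ 3 ≤ ‖z‖ ^ 2 + ‖z‖ + 1 := by
    refine le_of_mul_le_mul_left (a := ‖a‖) ?_ ha'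
    linarith
  nlinarith [mul_pos (sub_pos.2 h) (sub_pos.2 h), pow_pos (sub_pos.2 h) 3]

namespace Cubic

variable {F : Cubic ℤ} {α₁ β₁ α₂ β₂ s : ℂ}

/-- The product of the values of the linear factors at `(1, 0)`. -/
lemma IsFactorization.norm_mul_eq (h : F.IsFactorization α₁ β₁ α₂ β₂ s) :
    ‖α₁‖ * ‖α₂‖ * ‖α₁ + α₂‖ = ‖s‖ * |(F.a : ℝ)| := by
  rw [← norm_mul, ← norm_mul, ← norm_neg, ← h.a, norm_mul, Complex.norm_intCast]

lemma IsFactorization.eval_eq (h : F.IsFactorization α₁ β₁ α₂ β₂ s) (z : ℂ) :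
    s * (F.a * z ^ 3 + F.b * z ^ 2 + F.c * z + F.d) =
      -((α₁ * z + β₁) * (α₂ * z + β₂) * ((α₁ + α₂) * z + (β₁ + β₂))) := by
  linear_combination z ^ 3 * h.a + z ^ 2 * h.b + z * h.c + h.d

/-- Two zeros of linear factors are at distance `|L_k(1, 0)| / |a|`, where `L_k` is the third
factor. -/
lemma dist_eq_of_factors {α β α' β' γ z z' s : ℂ} {a : ℝ} (ha : 0 < a) (hs : 0 < ‖s‖)
    (hdet : ‖α * β' - α' * β‖ = ‖s‖) (hprod : ‖α‖ * ‖α'‖ * ‖γ‖ = ‖s‖ * a)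
    (hz : α * z + β = 0) (hz' : α' * z' + β' = 0) : ‖z - z'‖ * a = ‖γ‖ := by
  have h1 : ‖α‖ * ‖α'‖ * ‖z - z'‖ = ‖s‖ := by
    rw [← norm_mul, ← norm_mul, ← hdet]
    congr 1
    linear_combination α' * hz - α * hz'
  have h2 : 0 < ‖α‖ * ‖α'‖ := by
    have h0 : 0 < ‖α‖ * ‖α'‖ * ‖γ‖ := by rw [hprod]; positivity
    exact pos_of_mul_pos_left h0 (norm_nonneg _)
  refine mul_left_cancel₀ h2.ne' ?_
  rw [hprod, ← mul_assoc, h1]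

/-- The root spread of `F(X, 1)` is at most `Y / |a|` if its linear factors take values at most `Y`
at `(1, 0)`. -/
lemma IsFactorization.rootSpread_mul_le (h : F.IsFactorization α₁ β₁ α₂ β₂ s) (ha : F.a ≠ 0)
    {Y : ℝ} (h1 : ‖α₁‖ ≤ Y) (h2 : ‖α₂‖ ≤ Y) (h3 : ‖α₁ + α₂‖ ≤ Y) :
    rootSpread F.toPoly * |(F.a : ℝ)| ≤ Y := by
  have ha' : 0 < |(F.a : ℝ)| := abs_pos.2 (by exact_mod_cast ha)
  have hs : 0 < ‖s‖ := norm_pos_iff.2 h.ne_zero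
  have hY : 0 ≤ Y := (norm_nonneg _).trans h1
  rw [← le_div_iff₀ ha']
  refine Metric.diam_le_of_forall_dist_le (by positivity) ?_
  have key : ∀ z ∈ F.toPoly.rootSet ℂ, α₁ * z + β₁ = 0 ∨ α₂ * z + β₂ = 0 ∨
      (α₁ + α₂) * z + (β₁ + β₂) = 0 := by
    intro z hz
    have hz0 := (Polynomial.mem_rootSet.1 hz).2
    have h0 : (F.a * z ^ 3 + F.b * z ^ 2 + F.c * z + F.d : ℂ) = 0 := by
      simpa [toPoly] using hz0
    have h4 := h.eval_eq z
    rw [h0, mul_zero, eq_comm, neg_eq_zero, mul_eq_zero, mul_eq_zero, or_assoc] at h4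
    exact h4
  have hp := h.norm_mul_eq
  have d12 : ‖α₁ * β₂ - α₂ * β₁‖ = ‖s‖ := by rw [h.det]
  have d23 : ‖α₂ * (β₁ + β₂) - (α₁ + α₂) * β₂‖ = ‖s‖ := by
    rw [h.det, ← norm_neg]; congr 1; ring
  have d13 : ‖α₁ * (β₁ + β₂) - (α₁ + α₂) * β₁‖ = ‖s‖ := by rw [h.det]; congr 1; ring
  have p12 : ‖α₁‖ * ‖α₂‖ * ‖α₁ + α₂‖ = ‖s‖ * |(F.a : ℝ)| := hp
  have p23 : ‖α₂‖ * ‖α₁ + α₂‖ * ‖α₁‖ = ‖s‖ * |(F.a : ℝ)| := by rw [← hp]; ring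
  have p13 : ‖α₁‖ * ‖α₁ + α₂‖ * ‖α₂‖ = ‖s‖ * |(F.a : ℝ)| := by rw [← hp]; ring
  have hne : 0 < ‖α₁‖ * ‖α₂‖ * ‖α₁ + α₂‖ := by rw [hp]; positivity
  have n1 : α₁ ≠ 0 := by rintro rfl; simp at hne
  have n2 : α₂ ≠ 0 := by rintro rfl; simp at hne
  have n3 : α₁ + α₂ ≠ 0 := by intro h0; simp [h0] at hne
  have same : ∀ {α β z z' : ℂ}, α ≠ 0 → α * z + β = 0 → α * z' + β = 0 → z = z' := by
    intro α β z z' hα hz hz'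
    exact mul_left_cancel₀ hα (by linear_combination hz - hz')
  intro z hz z' hz'
  rw [le_div_iff₀ ha', dist_eq_norm]
  rcases key z hz with hz | hz | hz <;> rcases key z' hz' with hz' | hz' | hz'
  · rw [same n1 hz hz', sub_self]; simpa using hY
  · rw [dist_eq_of_factors ha' hs d12 p12 hz hz']; exact h3
  · rw [dist_eq_of_factors ha' hs d13 p13 hz hz']; exact h2
  · rw [norm_sub_rev, dist_eq_of_factors ha' hs d12 p12 hz' hz]; exact h3
  · rw [same n2 hz hz', sub_self]; simpa using hY
  · rw [dist_eq_of_factors ha' hs d23 p23 hz hz']; exact h1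
  · rw [norm_sub_rev, dist_eq_of_factors ha' hs d13 p13 hz' hz]; exact h2
  · rw [norm_sub_rev, dist_eq_of_factors ha' hs d23 p23 hz' hz]; exact h1
  · rw [same n3 hz hz', sub_self]; simpa using hY

/-- The leading coefficient is non-zero and has the largest absolute value of all coefficients. -/
structure IsDominated (F : Cubic ℤ) : Prop where
  ne_zero : F.a ≠ 0
  b_le : |F.b| ≤ |F.a|
  c_le : |F.c| ≤ |F.a|
  d_le : |F.d| ≤ |F.a|

/-- If the leading coefficient dominates, then the roots are at most `2` in absolute value, so that
the linear factors are at most `4 |a|` at `(1, 0)`. -/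
lemma IsFactorization.norm_le (h : F.IsFactorization α₁ β₁ α₂ β₂ s) (hF : F.IsDominated) :
    ‖α₁‖ ≤ 4 * |(F.a : ℝ)| ∧ ‖α₂‖ ≤ 4 * |(F.a : ℝ)| ∧ ‖α₁ + α₂‖ ≤ 4 * |(F.a : ℝ)| := by
  have ha' : 0 < |(F.a : ℝ)| := abs_pos.2 (by exact_mod_cast hF.ne_zero)
  have hs : 0 < ‖s‖ := norm_pos_iff.2 h.ne_zero
  have hp := h.norm_mul_eq
  have hne : 0 < ‖α₁‖ * ‖α₂‖ * ‖α₁ + α₂‖ := by rw [hp]; positivity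
  have n1 : α₁ ≠ 0 := by rintro rfl; simp at hne
  have n2 : α₂ ≠ 0 := by rintro rfl; simp at hne
  have n3 : α₁ + α₂ ≠ 0 := by intro h0; simp [h0] at hne
  have hroot : ∀ z : ℂ, (α₁ * z + β₁) * (α₂ * z + β₂) * ((α₁ + α₂) * z + (β₁ + β₂)) = 0 →
      ‖z‖ ≤ 2 := by
    intro z hz
    have h4 := h.eval_eq z
    rw [hz, neg_zero, mul_eq_zero] at h4
    refine norm_root_le_two (by exact_mod_cast hF.ne_zero) ?_ ?_ ?_ (h4.resolve_left h.ne_zero)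
    all_goals simp only [Complex.norm_intCast]
    · exact_mod_cast hF.b_le
    · exact_mod_cast hF.c_le
    · exact_mod_cast hF.d_le
  have e : ∀ {α : ℂ} (β : ℂ), α ≠ 0 → α * (-β / α) + β = 0 := by
    intro α β hα; field_simp; ring
  have r1 := hroot (-β₁ / α₁) (by rw [e β₁ n1]; ring)
  have r2 := hroot (-β₂ / α₂) (by rw [e β₂ n2]; ring)
  have r3 := hroot (-(β₁ + β₂) / (α₁ + α₂)) (by rw [e (β₁ + β₂) n3]; ring)
  have bound : ∀ {z z' : ℂ}, ‖z‖ ≤ 2 → ‖z'‖ ≤ 2 → ‖z - z'‖ * |(F.a : ℝ)| ≤ 4 * |(F.a : ℝ)| := by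
    intro z z' hz hz'
    exact mul_le_mul_of_nonneg_right ((norm_sub_le _ _).trans (by linarith)) ha'.le
  refine ⟨?_, ?_, ?_⟩
  · rw [← dist_eq_of_factors (s := s) (β := β₂) (β' := β₁ + β₂) ha' hs
      (by rw [h.det, ← norm_neg]; congr 1; ring) (by rw [← hp]; ring) (e _ n2) (e _ n3)]
    exact bound r2 r3
  · rw [← dist_eq_of_factors (s := s) (β := β₁) (β' := β₁ + β₂) ha' hs
      (by rw [h.det]; congr 1; ring) (by rw [← hp]; ring) (e _ n1) (e _ n3)]
    exact bound r1 r3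
  · rw [← dist_eq_of_factors (s := s) (β := β₁) (β' := β₂) ha' hs
      (by rw [h.det]) hp (e _ n1) (e _ n2)]
    exact bound r1 r2

end Cubic

/-! ### Counting dominated forms in one equivalence class -/

/-- Among three complex numbers with sum zero, the smallest one times the square of the largest is
at most twice the product. -/
lemma exists_max_and_mul_sq_le (A : Fin 3 → ℂ) (hA : A 0 + A 1 + A 2 = 0) :
    ∃ Y, (∀ i, ‖A i‖ ≤ Y) ∧ ‖A 0‖ * ‖A 1‖ * ‖A 2‖ ≤ Y ^ 3 ∧
      ∃ i, ‖A i‖ * Y ^ 2 ≤ 2 * (‖A 0‖ * ‖A 1‖ * ‖A 2‖) ∧ ∃ j, Y = ‖A j‖ := by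
  have key : ∀ x y z : ℂ, x + y + z = 0 → ‖x‖ ≤ ‖y‖ → ‖y‖ ≤ ‖z‖ →
      ‖x‖ * ‖z‖ ^ 2 ≤ 2 * (‖x‖ * ‖y‖ * ‖z‖) := by
    intro x y z h hxy hyz
    have h1 : ‖z‖ ≤ ‖x‖ + ‖y‖ := by
      rw [show z = -(x + y) by linear_combination h, norm_neg]; exact norm_add_le _ _
    have h2 : ‖z‖ ≤ 2 * ‖y‖ := by linarith
    nlinarith [mul_le_mul_of_nonneg_left h2 (mul_nonneg (norm_nonneg x) (norm_nonneg z))]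
  have hprod : ∀ Y, (∀ i, ‖A i‖ ≤ Y) → ‖A 0‖ * ‖A 1‖ * ‖A 2‖ ≤ Y ^ 3 := by
    intro Y hY
    have h0 : 0 ≤ Y := (norm_nonneg _).trans (hY 0)
    calc ‖A 0‖ * ‖A 1‖ * ‖A 2‖ ≤ Y * Y * Y := by
          gcongr <;> exact hY _
      _ = Y ^ 3 := by ring
  have fin : ∀ i j k : Fin 3, (∀ l, l = i ∨ l = j ∨ l = k) → A i + A j + A k = 0 →
      ‖A i‖ * ‖A j‖ * ‖A k‖ = ‖A 0‖ * ‖A 1‖ * ‖A 2‖ → ‖A i‖ ≤ ‖A j‖ → ‖A j‖ ≤ ‖A k‖ →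
      ∃ Y, (∀ i, ‖A i‖ ≤ Y) ∧ ‖A 0‖ * ‖A 1‖ * ‖A 2‖ ≤ Y ^ 3 ∧
        ∃ i, ‖A i‖ * Y ^ 2 ≤ 2 * (‖A 0‖ * ‖A 1‖ * ‖A 2‖) ∧ ∃ j, Y = ‖A j‖ := by
    intro i j k hl hs hp hij hjk
    have hle : ∀ l, ‖A l‖ ≤ ‖A k‖ := by
      intro l
      rcases hl l with rfl | rfl | rfl
      exacts [hij.trans hjk, hjk, le_rfl]
    exact ⟨‖A k‖, hle, hprod _ hle, i, hp ▸ key _ _ _ hs hij hjk, k, rfl⟩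
  rcases le_total ‖A 0‖ ‖A 1‖ with h01 | h01 <;> rcases le_total ‖A 1‖ ‖A 2‖ with h12 | h12 <;>
    rcases le_total ‖A 0‖ ‖A 2‖ with h02 | h02
  · exact fin 0 1 2 (by decide) hA (by ring) h01 h12
  · exact fin 0 1 2 (by decide) hA (by ring) h01 h12
  · exact fin 0 2 1 (by decide) (by linear_combination hA) (by ring) h02 h12
  · exact fin 2 0 1 (by decide) (by linear_combination hA) (by ring) h02 h01
  · exact fin 1 0 2 (by decide) (by linear_combination hA) (by ring) h01 h02
  · exact fin 1 2 0 (by decide) (by linear_combination hA) (by ring) h12 h02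
  · exact fin 2 1 0 (by decide) (by linear_combination hA) (by ring) h12 h01
  · exact fin 2 1 0 (by decide) (by linear_combination hA) (by ring) h12 h01

namespace Cubic

variable {F G : Cubic ℤ} {α₁ β₁ α₂ β₂ s : ℂ}

/-- The linear factors of a dominated form at `(1, 0)`: one of them is small compared with the
largest one, `Y`. The bound by `R` comes from the root spread `≥ 1 / R`, the one by `H` from the
size of the leading coefficient. -/
lemma IsFactorization.exists_small (h : F.IsFactorization α₁ β₁ α₂ β₂ s) (hF : F.IsDominated)
    {H R : ℝ} (hH : |(F.a : ℝ)| ≤ H) (hR : 0 < R) (hr : R⁻¹ ≤ rootSpread F.toPoly) :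
    ∃ Y, 1 ≤ Y ∧ Y ≤ 4 * H ∧ (∀ i, ‖![α₁, α₂, -(α₁ + α₂)] i‖ ≤ Y) ∧
      ∃ i, ‖![α₁, α₂, -(α₁ + α₂)] i‖ * Y ≤
        ‖s‖ * min (2 * R) ((2 * H) ^ (2 / 3 : ℝ) * ‖s‖ ^ (-1 / 3 : ℝ)) := by
  obtain ⟨Y, hY, hY3, i, hi, j, hj⟩ := exists_max_and_mul_sq_le ![α₁, α₂, -(α₁ + α₂)]
    (by simp)
  have ha : 1 ≤ |(F.a : ℝ)| := by exact_mod_cast Int.one_le_abs hF.ne_zero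
  have hs := h.one_le_norm
  have hs0 : 0 < ‖s‖ := by linarith
  have hH0 : 0 < H := by linarith
  have hprod : ‖![α₁, α₂, -(α₁ + α₂)] 0‖ * ‖![α₁, α₂, -(α₁ + α₂)] 1‖ *
      ‖![α₁, α₂, -(α₁ + α₂)] 2‖ = ‖s‖ * |(F.a : ℝ)| := by
    rw [← h.norm_mul_eq, ← norm_neg (α₁ + α₂)]; rfl
  have h4 := h.norm_le hF
  have h1 : ‖α₁‖ ≤ Y := hY 0
  have h2 : ‖α₂‖ ≤ Y := hY 1
  have h3 : ‖α₁ + α₂‖ ≤ Y := by rw [← norm_neg]; exact hY 2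
  have hspread := h.rootSpread_mul_le hF.ne_zero h1 h2 h3
  rw [hprod] at hi hY3
  have hY0 : 0 ≤ Y := (norm_nonneg _).trans h1
  have hY1 : 1 ≤ Y := by
    by_contra! hlt
    have : Y ^ 3 < 1 := pow_lt_one₀ hY0 hlt (by norm_num)
    nlinarith
  have hYa : Y ≤ 4 * |(F.a : ℝ)| := by
    rw [hj]
    fin_cases j
    · exact h4.1
    · exact h4.2.1
    · exact (norm_neg (α₁ + α₂)).le.trans h4.2.2
  have haR : |(F.a : ℝ)| ≤ R * Y := by
    have h5 : R⁻¹ * |(F.a : ℝ)| ≤ Y := (mul_le_mul_of_nonneg_right hr (by linarith)).trans hspread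
    rwa [inv_mul_le_iff₀ hR] at h5
  refine ⟨Y, hY1, hYa.trans (by linarith), hY, i, ?_⟩
  have hiY := hY i
  set t := ‖![α₁, α₂, -(α₁ + α₂)] i‖ with ht
  have ht0 : 0 ≤ t := norm_nonneg _
  rw [mul_min_of_nonneg _ _ hs0.le]
  refine le_min ?_ ?_
  · have h6 : t * Y * Y ≤ ‖s‖ * (2 * R) * Y := by
      have : ‖s‖ * |(F.a : ℝ)| ≤ ‖s‖ * (R * Y) := mul_le_mul_of_nonneg_left haR hs0.le
      nlinarith
    exact le_of_mul_le_mul_right h6 (by linarith)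
  · -- `(t Y)³ = (t Y²)² (t / Y) ≤ (2 |s| H)²`.
    have h6 : t * Y ^ 2 ≤ 2 * (‖s‖ * H) :=
      hi.trans (by gcongr)
    have h7 : (t * Y) ^ 3 ≤ (2 * H * ‖s‖) ^ 2 := by
      calc (t * Y) ^ 3 = t * Y ^ 2 * (t * (Y * t)) := by ring
        _ ≤ t * Y ^ 2 * (t * (Y * Y)) := by gcongr
        _ = (t * Y ^ 2) ^ 2 := by ring
        _ ≤ (2 * (‖s‖ * H)) ^ 2 := by gcongr
        _ = _ := by ring
    have h8 : ‖s‖ * ((2 * H) ^ (2 / 3 : ℝ) * ‖s‖ ^ (-1 / 3 : ℝ)) = (2 * H * ‖s‖) ^ (2 / 3 : ℝ) := by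
      rw [Real.mul_rpow (by positivity) hs0.le, mul_left_comm]
      congr 1
      nth_rewrite 1 [← Real.rpow_one ‖s‖]
      rw [← Real.rpow_add hs0]
      norm_num
    rw [h8]
    refine le_of_pow_le_pow_left₀ (n := 3) (by norm_num) (by positivity) (h7.trans (le_of_eq ?_))
    rw [← Real.rpow_natCast ((2 * H * ‖s‖) ^ (2 / 3 : ℝ)), ← Real.rpow_mul (by positivity),
      ← Real.rpow_natCast]
    norm_num

/-- The dominated forms properly equivalent to `G`, of height at most `H` and root spread at least
`1 / R`. Such a form `F(x, y) = G(p x + q y, r x + t y)` is determined by the primitive vector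
`(p, r)`, because changing `(q, t)` by `k (p, r)` changes its coefficient `b` by `3 k a`. -/
lemma IsFactorization.finite_and_ncard_le (h : G.IsFactorization α₁ β₁ α₂ β₂ s)
    (S : Set (Cubic ℤ)) {H R : ℝ} (hH : 1 ≤ H) (hR : 0 < R)
    (hS : ∀ F ∈ S, G.Equivalent F ∧ F.IsDominated ∧ |(F.a : ℝ)| ≤ H ∧
      R⁻¹ ≤ rootSpread F.toPoly) :
    S.Finite ∧ (S.ncard : ℝ) ≤ 3 * (Real.logb 2 (4 * H) + 1) *
      (2 + 36 * min (2 * R) ((2 * H) ^ (2 / 3 : ℝ) * ‖s‖ ^ (-1 / 3 : ℝ))) := by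
  have hs0 : 0 < ‖s‖ := norm_pos_iff.2 h.ne_zero
  choose! hS hdom hle hspread using hS
  choose! p q r t hdet hF using hS
  have hinj : Set.InjOn (fun F => (p F, r F)) S := by
    intro F hFS F' hFS' heq
    simp only [Prod.mk.injEq] at heq
    obtain ⟨e1, e2⟩ := heq
    have d1 := hdet F hFS
    have d2 := hdet F' hFS'
    rw [← e1, ← e2] at d2
    have f1 := hF F hFS
    have f2 := hF F' hFS'
    rw [← e1, ← e2] at f2
    set k := t F * q F' - q F * t F' with hk
    have hq : q F' = q F + k * p F := by
      rw [hk]; linear_combination q F' * (-d1) + q F * d2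
    have ht : t F' = t F + k * r F := by
      rw [hk]; linear_combination t F' * (-d1) + t F * d2
    have hFF : F' = F.subst 1 k 0 1 := by
      refine f2.trans (Eq.trans ?_ (congrArg (fun K => K.subst 1 k 0 1) f1).symm)
      simp only [subst_subst]
      rw [hq, ht]
      congr 1
      all_goals ring
    have ha : F'.a = F.a := by rw [hFF]; simp [Cubic.subst]
    have hb : F'.b = F.b + 3 * k * F.a := by rw [hFF]; simp [Cubic.subst]; ring
    have hk0 : k = 0 := by
      by_contra hk0
      have h1 := (hdom F hFS).b_le
      have h2 := (hdom F' hFS').b_le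
      have h3 : 0 < |F.a| := abs_pos.2 (hdom F hFS).ne_zero
      rw [ha] at h2
      have h4 : |3 * k * F.a| ≤ 2 * |F.a| := by
        rw [show 3 * k * F.a = F'.b - F.b by rw [hb]; ring]
        exact (abs_sub _ _).trans (by linarith)
      rw [abs_mul, abs_mul] at h4
      have h5 : 1 ≤ |k| := Int.one_le_abs hk0
      have h6 : |(3 : ℤ)| = 3 := rfl
      rw [h6] at h4
      nlinarith
    rw [hFF, hk0, subst_id]
  have hcount := finite_and_ncard_le_of_mul_le ((fun F => (p F, r F)) '' S)
    (by
      rintro _ ⟨F, hFS, rfl⟩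
      exact ⟨t F, -q F, by linear_combination hdet F hFS⟩)
    (fun i v => v.1 * ![α₁, α₂, -(α₁ + α₂)] i + v.2 * ![β₁, β₂, -(β₁ + β₂)] i) s h.ne_zero
    (by
      intro i v w
      have := h.det
      fin_cases i <;> (simp [wedge, this]; ring))
    (‖s‖ * min (2 * R) ((2 * H) ^ (2 / 3 : ℝ) * ‖s‖ ^ (-1 / 3 : ℝ))) (4 * H)
    (mul_nonneg hs0.le (le_min (by positivity) (by positivity))) (by linarith)
    (by
      rintro _ ⟨F, hFS, rfl⟩
      have hfac := h.subst (hdet F hFS)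
      rw [← hF F hFS] at hfac
      obtain ⟨Y, hY1, hYH, hY, i, hi⟩ := hfac.exists_small (hdom F hFS) (hle F hFS) hR
        (hspread F hFS)
      have e : ∀ i, ((p F : ℂ) * ![α₁, α₂, -(α₁ + α₂)] i + r F * ![β₁, β₂, -(β₁ + β₂)] i) =
          ![p F * α₁ + r F * β₁, p F * α₂ + r F * β₂,
            -(p F * α₁ + r F * β₁ + (p F * α₂ + r F * β₂))] i := by
        intro i
        fin_cases i <;> simp <;> ring
      refine ⟨Y, hY1, hYH, fun i => ?_, i, ?_⟩
      · simp only [e]; exact hY i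
      · simp only [e]; exact hi)
  rw [hinj.ncard_image, mul_div_cancel_left₀ _ hs0.ne'] at hcount
  exact ⟨Set.Finite.of_finite_image hcount.1 hinj, hcount.2⟩

end Cubic

/-! ### Reduction of binary cubic forms -/

/-- Two real linear forms of determinant `d ≠ 0` are simultaneously `O(√|d|)` at the first column of
some matrix in `SL₂(ℤ)`. This is the reduction of the point of the upper half-plane at which
`m + i n` vanishes to the fundamental domain. -/
lemma exists_sl2_sq_add_sq_le (m₁ m₂ n₁ n₂ : ℝ) (hd : m₁ * n₂ - m₂ * n₁ ≠ 0) :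
    ∃ p q r t : ℤ, p * t - q * r = 1 ∧
      (p * m₁ + r * m₂) ^ 2 + (p * n₁ + r * n₂) ^ 2 ≤ 2 * |m₁ * n₂ - m₂ * n₁| := by
  wlog hpos : 0 < m₁ * n₂ - m₂ * n₁ generalizing m₁ m₂ n₁ n₂
  · obtain ⟨p, q, r, t, h1, h2⟩ := this n₁ n₂ m₁ m₂ (fun h => hd (by linarith))
      (lt_of_le_of_ne (by linarith) (fun h => hd (by linarith)))
    refine ⟨p, q, r, t, h1, ?_⟩
    rw [show m₁ * n₂ - m₂ * n₁ = -(n₁ * m₂ - n₂ * m₁) by ring, abs_neg]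
    linarith
  have hN : 0 < m₁ ^ 2 + n₁ ^ 2 := by
    rcases eq_or_ne m₁ 0 with rfl | hm
    · have : n₁ ≠ 0 := by rintro rfl; simp at hd
      positivity
    · positivity
  set x : ℝ := (m₁ * m₂ + n₁ * n₂) / (m₁ ^ 2 + n₁ ^ 2) with hx
  set y : ℝ := (m₁ * n₂ - m₂ * n₁) / (m₁ ^ 2 + n₁ ^ 2) with hy
  have hy0 : 0 < y := by positivity
  set τ : UpperHalfPlane := ⟨⟨x, y⟩, hy0⟩ with hτ
  obtain ⟨γ, hγ⟩ := ModularGroup.exists_one_half_le_im_smul τ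
  rw [ModularGroup.im_smul_eq_div_normSq, ModularGroup.denom_apply,
    le_div_iff₀ (by rw [← ModularGroup.denom_apply]; exact UpperHalfPlane.normSq_denom_pos _ τ.im_ne_zero)] at hγ
  have him : τ.im = y := rfl
  have hcoe : (τ : ℂ) = ⟨x, y⟩ := rfl
  rw [him, hcoe] at hγ
  have hns : Complex.normSq ((γ 1 0 : ℂ) * ⟨x, y⟩ + (γ 1 1 : ℂ)) =
      (γ 1 0 * x + γ 1 1) ^ 2 + (γ 1 0 * y) ^ 2 := by
    rw [Complex.normSq_apply]
    simp
    ring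
  rw [hns] at hγ
  have hdet := γ.det_coe
  rw [Matrix.det_fin_two] at hdet
  refine ⟨γ 1 1, γ 0 1, γ 1 0, γ 0 0, by linarith, ?_⟩
  rw [abs_of_pos hpos]
  have e1 : x * (m₁ ^ 2 + n₁ ^ 2) = m₁ * m₂ + n₁ * n₂ := by rw [hx]; field_simp
  have e2 : y * (m₁ ^ 2 + n₁ ^ 2) = m₁ * n₂ - m₂ * n₁ := by rw [hy]; field_simp
  generalize (γ 1 0 : ℤ) = c at *
  generalize (γ 1 1 : ℤ) = e at *
  have e3 : (e * m₁ + c * m₂) ^ 2 + (e * n₁ + c * n₂) ^ 2 =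
      (m₁ ^ 2 + n₁ ^ 2) * ((c * x + e) ^ 2 + (c * y) ^ 2) := by
    refine mul_left_cancel₀ hN.ne' ?_
    have : (m₁ ^ 2 + n₁ ^ 2) * ((m₁ ^ 2 + n₁ ^ 2) * ((c * x + e) ^ 2 + (c * y) ^ 2)) =
      (c * (x * (m₁ ^ 2 + n₁ ^ 2)) + e * (m₁ ^ 2 + n₁ ^ 2)) ^ 2 +
        (c * (y * (m₁ ^ 2 + n₁ ^ 2))) ^ 2 := by ring
    rw [this, e1, e2]; ring
  rw [e3, ← e2]
  nlinarith

namespace Cubic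

variable {F G : Cubic ℤ} {α₁ β₁ α₂ β₂ s : ℂ}

/-- A real cubic has three real roots, or a real root and two complex conjugate ones. The dominance
of the leading coefficient locates a real root in `[-2, 2]`. -/
lemma IsDominated.exists_roots (hF : F.IsDominated) : ∃ x₁ x₂ x₃ : ℂ,
    (F.b : ℂ) = -F.a * (x₁ + x₂ + x₃) ∧ (F.c : ℂ) = F.a * (x₁ * x₂ + x₁ * x₃ + x₂ * x₃) ∧
    (F.d : ℂ) = -F.a * (x₁ * x₂ * x₃) ∧
    ((starRingEnd ℂ x₁ = x₁ ∧ starRingEnd ℂ x₂ = x₂ ∧ starRingEnd ℂ x₃ = x₃) ∨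
      (starRingEnd ℂ x₁ = x₁ ∧ starRingEnd ℂ x₂ = x₃ ∧ starRingEnd ℂ x₃ = x₂)) := by
  have ha : (F.a : ℝ) ≠ 0 := by exact_mod_cast hF.ne_zero
  obtain ⟨x, hx⟩ : ∃ x : ℝ, F.a * x ^ 3 + F.b * x ^ 2 + F.c * x + F.d = 0 := by
    have hb := abs_le.1 (show |(F.b : ℝ)| ≤ |(F.a : ℝ)| by exact_mod_cast hF.b_le)
    have hc := abs_le.1 (show |(F.c : ℝ)| ≤ |(F.a : ℝ)| by exact_mod_cast hF.c_le)
    have hd := abs_le.1 (show |(F.d : ℝ)| ≤ |(F.a : ℝ)| by exact_mod_cast hF.d_le)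
    have hcont : Continuous fun x : ℝ => (F.a : ℝ) * x ^ 3 + F.b * x ^ 2 + F.c * x + F.d := by
      fun_prop
    have hmem : (0 : ℝ) ∈ Set.uIcc ((F.a : ℝ) * (-2) ^ 3 + F.b * (-2) ^ 2 + F.c * (-2) + F.d)
        ((F.a : ℝ) * 2 ^ 3 + F.b * 2 ^ 2 + F.c * 2 + F.d) := by
      rw [Set.mem_uIcc]
      rcases abs_cases (F.a : ℝ) with ⟨h, h'⟩ | ⟨h, h'⟩ <;> rw [h] at hb hc hd
      · left; constructor <;> linarith
      · right; constructor <;> linarith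
    obtain ⟨x, -, hx⟩ := intermediate_value_uIcc (a := (-2 : ℝ)) (b := 2) hcont.continuousOn hmem
    exact ⟨x, hx⟩
  -- `F = a (X - x) (X² + u X + v)`
  set u : ℝ := F.b / F.a + x with hu
  set v : ℝ := F.c / F.a + x * u with hv
  have e1 : (F.b : ℝ) = F.a * (u - x) := by rw [hu]; field_simp; ring
  have e2 : (F.c : ℝ) = F.a * (v - x * u) := by rw [hv]; field_simp; ring
  have e3 : (F.d : ℝ) = -F.a * (x * v) := by
    rw [e1, e2] at hx; linear_combination hx
  have c1 : (F.b : ℂ) = F.a * (u - x) := by exact_mod_cast congrArg (fun t : ℝ => (t : ℂ)) e1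
  have c2 : (F.c : ℂ) = F.a * (v - x * u) := by exact_mod_cast congrArg (fun t : ℝ => (t : ℂ)) e2
  have c3 : (F.d : ℂ) = -F.a * (x * v) := by exact_mod_cast congrArg (fun t : ℝ => (t : ℂ)) e3
  rcases le_total 0 (u ^ 2 - 4 * v) with hD | hD
  · set w := √(u ^ 2 - 4 * v) with hw
    have hw2 : (w : ℂ) ^ 2 = u ^ 2 - 4 * v := by
      exact_mod_cast congrArg (fun t : ℝ => (t : ℂ)) (Real.sq_sqrt hD)
    refine ⟨x, ((-u + w) / 2 : ℝ), ((-u - w) / 2 : ℝ), ?_, ?_, ?_,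
      Or.inl ⟨Complex.conj_ofReal _, Complex.conj_ofReal _, Complex.conj_ofReal _⟩⟩
    · rw [c1]; push_cast; ring
    · rw [c2]; push_cast; linear_combination (F.a : ℂ) / 4 * hw2
    · rw [c3]; push_cast; linear_combination -(F.a : ℂ) * x / 4 * hw2
  · set w := √(4 * v - u ^ 2) with hw
    have hw2 : (w : ℂ) ^ 2 = 4 * v - u ^ 2 := by
      exact_mod_cast congrArg (fun t : ℝ => (t : ℂ)) (Real.sq_sqrt (show 0 ≤ 4 * v - u ^ 2 by linarith))
    have hI : Complex.I ^ 2 = -1 := Complex.I_sq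
    refine ⟨x, (-u + w * Complex.I) / 2, (-u - w * Complex.I) / 2, ?_, ?_, ?_,
      Or.inr ⟨Complex.conj_ofReal _, ?_, ?_⟩⟩
    · rw [c1]; ring
    · rw [c2]; linear_combination (F.a : ℂ) * w ^ 2 / 4 * hI - (F.a : ℂ) / 4 * hw2
    · rw [c3]; linear_combination -(F.a : ℂ) * x * w ^ 2 / 4 * hI + (F.a : ℂ) * x / 4 * hw2
    · simp [Complex.conj_ofReal, map_ofNat]; ring
    · simp [Complex.conj_ofReal, map_ofNat]

/-- Every dominated form is properly equivalent to a form whose linear factors are `O(√|s|)` at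
`(1, 0)`; this bounds the leading coefficients of that form and of its Hessian. -/
lemma IsDominated.exists_equivalent (hF : F.IsDominated) (h0 : F.discr ≠ 0) :
    (∃ α₁ β₁ α₂ β₂ s, F.IsFactorization α₁ β₁ α₂ β₂ s) ∧
    ∃ G, F.Equivalent G ∧ |(G.a : ℝ)| ≤ 16 * |(F.discr : ℝ)| ^ (1 / 4 : ℝ) ∧
      |(G.b : ℝ) ^ 2 - 3 * G.a * G.c| ≤ 12 * (|(F.discr : ℝ)| ^ (1 / 4 : ℝ)) ^ 2 := by
  obtain ⟨x₁, x₂, x₃, hb, hc, hd, hreal⟩ := hF.exists_roots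
  have hfac := isFactorization_of_roots hb hc hd h0
  refine ⟨⟨_, _, _, _, _, hfac⟩, ?_⟩
  set α₁ := (F.a : ℂ) * (x₃ - x₁)
  set α₂ := (F.a : ℂ) * (x₁ - x₂)
  set β₁ := -x₂ * α₁
  set β₂ := -x₃ * α₂
  set s := (F.a : ℂ) ^ 2 * ((x₃ - x₁) * (x₁ - x₂) * (x₂ - x₃))
  have hs0 : 0 < ‖s‖ := norm_pos_iff.2 hfac.ne_zero
  obtain ⟨p, q, r, t, hdet, h1, h2⟩ : ∃ p q r t : ℤ, p * t - q * r = 1 ∧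
      ‖p * α₁ + r * β₁‖ ^ 2 ≤ 4 * ‖s‖ ∧ ‖p * α₂ + r * β₂‖ ^ 2 ≤ 4 * ‖s‖ := by
    rcases hreal with ⟨k1, k2, k3⟩ | ⟨k1, k2, k3⟩
    · -- All linear factors are real.
      rw [Complex.conj_eq_iff_real] at k1 k2 k3
      obtain ⟨y₁, hy1⟩ := k1
      obtain ⟨y₂, hy2⟩ := k2
      obtain ⟨y₃, hy3⟩ := k3
      have a1 : α₁ = ((F.a * (y₃ - y₁) : ℝ) : ℂ) := by simp only [α₁, hy1, hy3]; push_cast; ring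
      have a2 : α₂ = ((F.a * (y₁ - y₂) : ℝ) : ℂ) := by simp only [α₂, hy1, hy2]; push_cast; ring
      have b1 : β₁ = ((-y₂ * (F.a * (y₃ - y₁)) : ℝ) : ℂ) := by
        simp only [β₁, a1, hy2]; push_cast; ring
      have b2 : β₂ = ((-y₃ * (F.a * (y₁ - y₂)) : ℝ) : ℂ) := by
        simp only [β₂, a2, hy3]; push_cast; ring
      have hsd := hfac.det
      generalize (F.a * (y₃ - y₁) : ℝ) = m₁ at a1 b1
      generalize (F.a * (y₁ - y₂) : ℝ) = n₁ at a2 b2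
      generalize -y₂ * m₁ = m₂ at b1
      generalize -y₃ * n₁ = n₂ at b2
      have hs' : s = ((m₁ * n₂ - m₂ * n₁ : ℝ) : ℂ) := by
        rw [hsd, a1, a2, b1, b2]; push_cast; ring
      have hns : ‖s‖ = |m₁ * n₂ - m₂ * n₁| := by rw [hs', Complex.norm_real, Real.norm_eq_abs]
      obtain ⟨p, q, r, t, hdet, hle⟩ := exists_sl2_sq_add_sq_le m₁ m₂ n₁ n₂
        (by rw [hns] at hs0; exact abs_pos.1 hs0)
      refine ⟨p, q, r, t, hdet, ?_, ?_⟩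
      · rw [a1, b1, show ((p : ℂ) * (m₁ : ℂ) + r * (m₂ : ℂ)) = ((p * m₁ + r * m₂ : ℝ) : ℂ) by
          push_cast; ring, Complex.norm_real, Real.norm_eq_abs, sq_abs, hns]
        nlinarith [sq_nonneg (p * n₁ + r * n₂)]
      · rw [a2, b2, show ((p : ℂ) * (n₁ : ℂ) + r * (n₂ : ℂ)) = ((p * n₁ + r * n₂ : ℝ) : ℂ) by
          push_cast; ring, Complex.norm_real, Real.norm_eq_abs, sq_abs, hns]
        nlinarith [sq_nonneg (p * m₁ + r * m₂)]
    · -- The second factor is minus the conjugate of the first one.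
      have a2 : α₂ = -starRingEnd ℂ α₁ := by
        simp only [α₁, α₂, map_mul, map_sub, map_intCast, k1, k3]; ring
      have b2 : β₂ = -starRingEnd ℂ β₁ := by
        simp only [β₁, β₂, map_mul, map_neg, k2, a2]; ring
      have hns : ‖s‖ = 2 * |α₁.re * β₁.im - β₁.re * α₁.im| := by
        have : s = ((2 * (α₁.re * β₁.im - β₁.re * α₁.im) : ℝ) : ℂ) * Complex.I := by
          rw [hfac.det, a2, b2]
          apply Complex.ext <;> simp <;> ring
        rw [this, norm_mul, Complex.norm_I, mul_one, Complex.norm_real, Real.norm_eq_abs, abs_mul]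
        norm_num
      obtain ⟨p, q, r, t, hdet, hle⟩ := exists_sl2_sq_add_sq_le α₁.re β₁.re α₁.im β₁.im
        (by rw [hns] at hs0; exact abs_pos.1 (by linarith))
      have hle' : ‖p * α₁ + r * β₁‖ ^ 2 ≤ 4 * ‖s‖ := by
        rw [Complex.sq_norm, Complex.normSq_apply, hns]
        simp
        nlinarith [abs_nonneg (α₁.re * β₁.im - β₁.re * α₁.im)]
      refine ⟨p, q, r, t, hdet, hle', ?_⟩
      have : (p * α₂ + r * β₂ : ℂ) = -starRingEnd ℂ (p * α₁ + r * β₁) := by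
        rw [a2, b2]; simp; ring
      rw [this, norm_neg, Complex.norm_conj]
      exact hle'
  have hG := hfac.subst hdet
  refine ⟨_, ⟨p, q, r, t, hdet, rfl⟩, ?_⟩
  set G := F.subst p q r t
  set A := p * α₁ + r * β₁
  set B := p * α₂ + r * β₂
  -- `y = √|s|`, a fourth root of the discriminant
  set y := |(F.discr : ℝ)| ^ (1 / 4 : ℝ) with hy
  have hy0 : 0 ≤ y := by positivity
  have hy2 : y ^ 2 = ‖s‖ := by
    rw [hy, ← Real.rpow_natCast, ← Real.rpow_mul (abs_nonneg _), ← hfac.norm_sq,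
      ← Real.rpow_natCast, ← Real.rpow_mul hs0.le]
    norm_num
  have hA : ‖A‖ ≤ 2 * y := by
    refine le_of_pow_le_pow_left₀ (n := 2) (by norm_num) (by positivity) ?_
    rw [mul_pow, hy2]; linarith
  have hB : ‖B‖ ≤ 2 * y := by
    refine le_of_pow_le_pow_left₀ (n := 2) (by norm_num) (by positivity) ?_
    rw [mul_pow, hy2]; linarith
  have hAB : ‖A + B‖ ≤ 4 * y := (norm_add_le _ _).trans (by linarith)
  have hypos : 0 < y ^ 2 := by rw [hy2]; exact hs0
  constructor
  · have h5 := hG.norm_mul_eq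
    rw [← hy2] at h5
    have h6 : ‖A‖ * ‖B‖ * ‖A + B‖ ≤ 2 * y * (2 * y) * (4 * y) := by gcongr
    rw [h5] at h6
    refine le_of_mul_le_mul_left (a := y ^ 2) ?_ hypos
    linarith
  · have h5 := hG.hessian_eq
    have h6 : ((G.b : ℂ) ^ 2 - 3 * G.a * G.c) = (((G.b : ℝ) ^ 2 - 3 * G.a * G.c : ℝ) : ℂ) := by
      push_cast; ring
    rw [h6] at h5
    rw [← Real.norm_eq_abs, ← Complex.norm_real, h5]
    refine norm_add₃_le.trans ?_
    rw [norm_pow, norm_pow, norm_mul]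
    calc ‖A‖ ^ 2 + ‖A‖ * ‖B‖ + ‖B‖ ^ 2 ≤ (2 * y) ^ 2 + (2 * y) * (2 * y) + (2 * y) ^ 2 := by gcongr
      _ = 12 * y ^ 2 := by ring

end Cubic

/-! ### Counting reduced forms -/

/-- Comparison of `∑ x^(-3/2)` with `∫ x^(-3/2)`. -/
lemma sum_range_inv_mul_sqrt_le {u : ℝ} (hu : 1 ≤ u) (N : ℕ) :
    ∑ n ∈ Finset.range N, 1 / ((u + n) * √(u + n)) ≤ 4 / √u := by
  have hstep : ∀ x : ℝ, 1 ≤ x → 1 / (x * √x) ≤ 4 / √x - 4 / √(x + 1) := by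
    intro x hx
    have hp : 0 < √x := Real.sqrt_pos.2 (by linarith)
    have hq : 0 < √(x + 1) := Real.sqrt_pos.2 (by linarith)
    have hp2 : √x ^ 2 = x := Real.sq_sqrt (by linarith)
    have hq2 : √(x + 1) ^ 2 = x + 1 := Real.sq_sqrt (by linarith)
    have e : (√(x + 1) - √x) * (√(x + 1) + √x) = 1 := by linear_combination hq2 - hp2
    rw [div_sub_div _ _ hp.ne' hq.ne', div_le_div_iff₀ (by positivity) (by positivity)]
    have h1 : √(x + 1) * (√(x + 1) + √x) ≤ 4 * x := by
      nlinarith [sq_nonneg (√(x + 1) - √x)]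
    have h2 : √(x + 1) ≤ 4 * x * (√(x + 1) - √x) := by
      have h3 : 0 ≤ √(x + 1) - √x := by
        have := Real.sqrt_le_sqrt (show x ≤ x + 1 by linarith)
        linarith
      calc √(x + 1) = √(x + 1) * (√(x + 1) + √x) * (√(x + 1) - √x) := by
            linear_combination -√(x + 1) * e
        _ ≤ 4 * x * (√(x + 1) - √x) := mul_le_mul_of_nonneg_right h1 h3
    nlinarith [mul_le_mul_of_nonneg_left h2 hp.le]
  have key : ∀ N : ℕ, ∑ n ∈ Finset.range N, 1 / ((u + n) * √(u + n)) ≤ 4 / √u - 4 / √(u + N) := by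
    intro N
    induction N with
    | zero => simp
    | succ N ih =>
      rw [Finset.sum_range_succ]
      have := hstep (u + N) (by linarith [Nat.cast_nonneg (α := ℝ) N])
      push_cast
      rw [← add_assoc]
      linarith
  refine (key N).trans ?_
  have : 0 ≤ 4 / √(u + N) := by positivity
  linarith

lemma sum_range_inv_sqrt_le (N : ℕ) :
    ∑ n ∈ Finset.range N, 1 / √((n : ℝ) + 1) ≤ 2 * √N := by
  induction N with
  | zero => simp
  | succ N ih =>
    rw [Finset.sum_range_succ]
    have hq : 0 < √((N : ℝ) + 1) := Real.sqrt_pos.2 (by positivity)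
    have hp2 : √(N : ℝ) ^ 2 = N := Real.sq_sqrt (by positivity)
    have hq2 : √((N : ℝ) + 1) ^ 2 = N + 1 := Real.sq_sqrt (by positivity)
    have : 1 / √((N : ℝ) + 1) ≤ 2 * √((N : ℝ) + 1) - 2 * √N := by
      rw [div_le_iff₀ hq]
      nlinarith [sq_nonneg (√((N : ℝ) + 1) - √N)]
    push_cast
    linarith

lemma sum_range_inv_sq_le (N : ℕ) : ∑ n ∈ Finset.range N, 1 / ((n : ℝ) + 1) ^ 2 ≤ 2 := by
  have key : ∀ N : ℕ, ∑ n ∈ Finset.range (N + 1), 1 / ((n : ℝ) + 1) ^ 2 ≤ 2 - 1 / ((N : ℝ) + 1) := by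
    intro N
    induction N with
    | zero => norm_num
    | succ N ih =>
      rw [Finset.sum_range_succ]
      have : 1 / ((N : ℝ) + 1 + 1) ^ 2 ≤ 1 / ((N : ℝ) + 1) - 1 / ((N : ℝ) + 1 + 1) := by
        rw [div_sub_div _ _ (by positivity) (by positivity),
          div_le_div_iff₀ (by positivity) (by positivity)]
        nlinarith [Nat.cast_nonneg (α := ℝ) N]
      push_cast
      linarith
  cases N with
  | zero => simp
  | succ N =>
    refine (key N).trans ?_
    have : 0 ≤ 1 / ((N : ℝ) + 1) := by positivity
    linarith

namespace Cubic

/-- The value at `(1, 0)` of the cubic covariant of a binary cubic form. -/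
def covariantCoeff (F : Cubic ℤ) : ℤ := 2 * F.b ^ 3 - 9 * F.a * F.b * F.c + 27 * F.a ^ 2 * F.d

/-- The syzygy between the discriminant, the Hessian and the cubic covariant. -/
lemma covariantCoeff_sq (F : Cubic ℤ) :
    F.covariantCoeff ^ 2 = 4 * (F.b ^ 2 - 3 * F.a * F.c) ^ 3 - 27 * F.a ^ 2 * F.discr := by
  simp only [covariantCoeff, discr]; ring

/-- If `T²` and `T'²` lie in the interval of radius `27 a² y⁴` about `4 h³`, and `T`, `T'` have the
same sign, then `x = |T - T'| / (27 a²)` satisfies `a² x² ≪ y⁴` and `|h|³ x² ≪ y⁸`. -/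
lemma sq_mul_le_of_covariant_close {a h T T' y x : ℝ} (ha : a ≠ 0)
    (hT : |4 * h ^ 3 - T ^ 2| ≤ 27 * a ^ 2 * y ^ 4)
    (hT' : |4 * h ^ 3 - T' ^ 2| ≤ 27 * a ^ 2 * y ^ 4) (hsgn : 0 ≤ T * T')
    (hx : |T - T'| = 27 * a ^ 2 * x) :
    a ^ 2 * x ^ 2 ≤ y ^ 4 ∧ |h| ^ 3 * x ^ 2 ≤ y ^ 8 := by
  have ha2 : 0 < a ^ 2 := by positivity
  have hx0 : 0 ≤ x := by
    have : 0 ≤ 27 * a ^ 2 * x := hx ▸ abs_nonneg _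
    by_contra! hneg
    nlinarith
  have hy4 : 0 ≤ y ^ 4 := by positivity
  rw [abs_le] at hT hT'
  have hsq : (T - T') ^ 2 = (27 * a ^ 2 * x) ^ 2 := by rw [← hx, sq_abs]
  have hdiff : |T ^ 2 - T' ^ 2| ≤ 54 * a ^ 2 * y ^ 4 := by
    rw [abs_le]; constructor <;> linarith
  have hfac : |T ^ 2 - T' ^ 2| = 27 * a ^ 2 * x * |T + T'| := by
    rw [show T ^ 2 - T' ^ 2 = (T - T') * (T + T') by ring, abs_mul, hx]
  have hsum : x * |T + T'| ≤ 2 * y ^ 4 := by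
    rw [hfac] at hdiff
    refine le_of_mul_le_mul_left (a := 27 * a ^ 2) ?_ (by positivity)
    linarith
  have hge : 27 * a ^ 2 * x ≤ |T + T'| := by
    rw [← hx]
    refine sq_le_sq.1 ?_
    nlinarith
  have h1 : 27 * (a ^ 2 * x ^ 2) ≤ 2 * y ^ 4 := by
    calc 27 * (a ^ 2 * x ^ 2) = x * (27 * a ^ 2 * x) := by ring
      _ ≤ x * |T + T'| := by gcongr
      _ ≤ _ := hsum
  refine ⟨by nlinarith [mul_nonneg ha2.le (sq_nonneg x)], ?_⟩
  have hy8 : y ^ 8 = y ^ 4 * y ^ 4 := by ring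
  rcases le_total (54 * a ^ 2 * y ^ 4) (4 * h ^ 3) with hh | hh
  · -- `T` and `T'` are bounded away from zero.
    have hh0 : 0 ≤ h := by
      by_contra! hneg
      have : h ^ 3 < 0 := by
        have := mul_pos_of_neg_of_neg hneg hneg
        nlinarith
      nlinarith [mul_nonneg ha2.le hy4]
    rw [abs_of_nonneg hh0]
    have h2 : 4 * h ^ 3 ≤ |T + T'| ^ 2 := by rw [sq_abs]; nlinarith
    have h3 : (x * |T + T'|) ^ 2 ≤ (2 * y ^ 4) ^ 2 := by gcongr
    nlinarith [mul_le_mul_of_nonneg_left h2 (sq_nonneg x)]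
  · have h2 : |h| ^ 3 ≤ 27 / 2 * (a ^ 2 * y ^ 4) := by
      rw [← abs_pow, abs_le]
      constructor <;> nlinarith [sq_nonneg T]
    calc |h| ^ 3 * x ^ 2 ≤ 27 / 2 * (a ^ 2 * y ^ 4) * x ^ 2 := by gcongr
      _ = y ^ 4 * (27 * (a ^ 2 * x ^ 2)) / 2 := by ring
      _ ≤ y ^ 4 * (2 * y ^ 4) / 2 := by gcongr
      _ = y ^ 8 := by ring

/-- Two forms with the same coefficients `a`, `b`, `c` and covariants of the same sign: the distance
of their last coefficients. -/
lemma abs_d_sub_le {F F' : Cubic ℤ} {y n : ℝ} (hy : 1 ≤ y) (hn : 0 ≤ n) (ha : F.a ≠ 0)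
    (hay : |(F.a : ℝ)| ≤ 16 * y) (h1 : F'.a = F.a) (h2 : F'.b = F.b) (h3 : F'.c = F.c)
    (hsgn : 0 ≤ F.covariantCoeff ↔ 0 ≤ F'.covariantCoeff)
    (hD : |(F.discr : ℝ)| ≤ y ^ 4) (hD' : |(F'.discr : ℝ)| ≤ y ^ 4)
    (hnc : 3 * |(F.a : ℝ)| * n ≤ |(F.b : ℝ) ^ 2 - 3 * F.a * F.c|) :
    |(F.d : ℝ) - F'.d| ≤
      9 * y ^ 4 / (|(F.a : ℝ)| * √|(F.a : ℝ)|) * (1 / ((y + n) * √(y + n))) := by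
  have haR : (F.a : ℝ) ≠ 0 := by exact_mod_cast ha
  have hA : 0 < |(F.a : ℝ)| := abs_pos.2 haR
  have hy0 : 0 < y := by linarith
  have interval : ∀ K : Cubic ℤ, K.a = F.a → K.b = F.b → K.c = F.c → |(K.discr : ℝ)| ≤ y ^ 4 →
      |4 * ((F.b : ℝ) ^ 2 - 3 * F.a * F.c) ^ 3 - (K.covariantCoeff : ℝ) ^ 2| ≤
        27 * (F.a : ℝ) ^ 2 * y ^ 4 := by
    intro K k1 k2 k3 hK
    have : (K.covariantCoeff : ℝ) ^ 2 =
        4 * ((F.b : ℝ) ^ 2 - 3 * F.a * F.c) ^ 3 - 27 * (F.a : ℝ) ^ 2 * K.discr := by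
      rw [← k1, ← k2, ← k3]; exact_mod_cast K.covariantCoeff_sq
    rw [this, sub_sub_cancel, abs_mul, abs_of_nonneg (by positivity : 0 ≤ 27 * (F.a : ℝ) ^ 2)]
    gcongr
  obtain ⟨k1, k2⟩ := sq_mul_le_of_covariant_close (x := |(F.d : ℝ) - F'.d|) haR
    (interval F rfl rfl rfl hD) (interval F' h1 h2 h3 hD')
    (by
      rcases le_total 0 F.covariantCoeff with h | h
      · exact mul_nonneg (by exact_mod_cast h) (by exact_mod_cast hsgn.1 h)
      · rcases h.lt_or_eq with h | h
        · have h' : F'.covariantCoeff ≤ 0 := by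
            by_contra! h'
            exact absurd (hsgn.2 h'.le) (not_le.2 h)
          exact mul_nonneg_of_nonpos_of_nonpos (by exact_mod_cast h.le) (by exact_mod_cast h')
        · rw [h]; simp)
    (by
      rw [← abs_of_nonneg (by positivity : 0 ≤ 27 * (F.a : ℝ) ^ 2), ← abs_mul]
      simp only [covariantCoeff, h1, h2, h3]
      push_cast
      congr 1
      ring)
  set x := |(F.d : ℝ) - F'.d|
  set A := |(F.a : ℝ)|
  have hx0 : 0 ≤ x := abs_nonneg _
  rw [← sq_abs (F.a : ℝ)] at k1
  change A ^ 2 * x ^ 2 ≤ y ^ 4 at k1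
  have k3 : (3 * A * n) ^ 3 * x ^ 2 ≤ y ^ 8 := le_trans (by gcongr) k2
  have k4 : A ^ 3 * y ^ 3 * x ^ 2 ≤ 16 * y ^ 8 := by
    calc A ^ 3 * y ^ 3 * x ^ 2 = A * y ^ 3 * (A ^ 2 * x ^ 2) := by ring
      _ ≤ 16 * y * y ^ 3 * y ^ 4 := by gcongr
      _ = _ := by ring
  have k5 : (y + n) ^ 3 ≤ 4 * (y ^ 3 + n ^ 3) := by
    nlinarith [mul_nonneg (add_nonneg hy0.le hn) (sq_nonneg (y - n))]
  have k6 : (x * ((A * √A) * ((y + n) * √(y + n)))) ^ 2 ≤ (9 * y ^ 4) ^ 2 := by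
    have e1 : √A ^ 2 = A := Real.sq_sqrt hA.le
    have e2 : √(y + n) ^ 2 = y + n := Real.sq_sqrt (by linarith)
    calc (x * ((A * √A) * ((y + n) * √(y + n)))) ^ 2
        = x ^ 2 * A ^ 2 * √A ^ 2 * (y + n) ^ 2 * √(y + n) ^ 2 := by ring
      _ = x ^ 2 * A ^ 3 * (y + n) ^ 3 := by rw [e1, e2]; ring
      _ ≤ x ^ 2 * A ^ 3 * (4 * (y ^ 3 + n ^ 3)) := by gcongr
      _ = 4 * (A ^ 3 * y ^ 3 * x ^ 2) + 4 / 27 * ((3 * A * n) ^ 3 * x ^ 2) := by ring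
      _ ≤ 4 * (16 * y ^ 8) + 4 / 27 * y ^ 8 := by gcongr
      _ ≤ (9 * y ^ 4) ^ 2 := by nlinarith [pow_pos hy0 8]
  have hyn : 0 < y + n := by linarith
  have hsA : 0 < √A := Real.sqrt_pos.2 hA
  have hsy : 0 < √(y + n) := Real.sqrt_pos.2 hyn
  rw [div_mul_div_comm, mul_one, le_div_iff₀ (by positivity)]
  exact le_of_pow_le_pow_left₀ (n := 2) (by norm_num) (by positivity) k6

/-- Forms with given `a ≠ 0` and `b`. They are sorted by the side of `b² / (3a)` on which `c` lies,
by the integer part `n` of its distance, and by the sign of the cubic covariant; the bound for `d`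
in each of these classes is summed over `n`. -/
lemma finite_and_ncard_le_of_a_b (y : ℝ) (hy : 1 ≤ y) (a b : ℤ) (ha : a ≠ 0)
    (hay : |(a : ℝ)| ≤ 16 * y) (S : Set (Cubic ℤ))
    (hS : ∀ F ∈ S, F.a = a ∧ F.b = b ∧ |(F.discr : ℝ)| ≤ y ^ 4 ∧
      |(F.b : ℝ) ^ 2 - 3 * F.a * F.c| ≤ 12 * y ^ 2) :
    S.Finite ∧ (S.ncard : ℝ) ≤
      16 * y ^ 2 / |(a : ℝ)| + 4 + 144 * y ^ 4 / (|(a : ℝ)| * √|(a : ℝ)| * √y) := by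
  classical
  have haR : (a : ℝ) ≠ 0 := by exact_mod_cast ha
  have hA : 0 < |(a : ℝ)| := abs_pos.2 haR
  have hsA : 0 < √|(a : ℝ)| := Real.sqrt_pos.2 hA
  have hy0 : 0 < y := by linarith
  set c₀ : ℝ := b ^ 2 / (3 * a) with hc₀
  have hdist : ∀ F ∈ S, |(F.b : ℝ) ^ 2 - 3 * F.a * F.c| = 3 * |(a : ℝ)| * |F.c - c₀| := by
    intro F hF
    obtain ⟨h1, h2, -⟩ := hS F hF
    rw [h1, h2, show (b : ℝ) ^ 2 - 3 * a * F.c = -(3 * a * (F.c - c₀)) by rw [hc₀]; field_simp; ring,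
      abs_neg, abs_mul, abs_mul, abs_of_pos (by norm_num : (0 : ℝ) < 3)]
  set w : ℕ → ℝ := fun n => 9 * y ^ 4 / (|(a : ℝ)| * √|(a : ℝ)|) * (1 / ((y + n) * √(y + n)))
    with hw
  have hw0 : ∀ n, 0 ≤ w n := fun n => by
    have : 0 ≤ y + n := by positivity
    positivity
  set N := ⌊4 * y ^ 2 / |(a : ℝ)|⌋₊ + 1 with hN
  obtain ⟨h1, h2⟩ := finite_and_ncard_le_sum_of_fibers S
    (fun F => (⌊|F.c - c₀|⌋₊, (decide (c₀ ≤ F.c), decide (0 ≤ F.covariantCoeff))))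
    (Finset.range N ×ˢ (Finset.univ : Finset (Bool × Bool))) (fun t => w t.1 + 1)
    (by
      intro F hF
      simp only [Finset.mem_product, Finset.mem_range, Finset.mem_univ, and_true]
      refine Nat.lt_succ_of_le (Nat.floor_mono ?_)
      rw [le_div_iff₀ hA]
      have h3 := (hS F hF).2.2.2
      rw [hdist F hF] at h3
      linarith)
    (by
      rintro ⟨n, σ, τ⟩ _
      have hfib : ∀ F ∈ {F ∈ S | (⌊|F.c - c₀|⌋₊, (decide (c₀ ≤ F.c),
          decide (0 ≤ F.covariantCoeff))) = (n, (σ, τ))}, F ∈ S ∧ (n : ℝ) ≤ |F.c - c₀| ∧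
          |F.c - c₀| < n + 1 ∧ decide (c₀ ≤ F.c) = σ ∧ decide (0 ≤ F.covariantCoeff) = τ := by
        rintro F ⟨hF, hFt⟩
        simp only [Prod.mk.injEq] at hFt
        obtain ⟨hn, hσ, hτ⟩ := hFt
        exact ⟨hF, hn ▸ Nat.floor_le (abs_nonneg _), hn ▸ Nat.lt_floor_add_one _, hσ, hτ⟩
      have hceq : ∀ F ∈ {F ∈ S | (⌊|F.c - c₀|⌋₊, (decide (c₀ ≤ F.c),
          decide (0 ≤ F.covariantCoeff))) = (n, (σ, τ))}, ∀ F' ∈ {F ∈ S | (⌊|F.c - c₀|⌋₊,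
          (decide (c₀ ≤ F.c), decide (0 ≤ F.covariantCoeff))) = (n, (σ, τ))}, F'.c = F.c := by
        intro F hF F' hF'
        obtain ⟨-, p1, p2, p3, -⟩ := hfib F hF
        obtain ⟨-, q1, q2, q3, -⟩ := hfib F' hF'
        rw [← q3, decide_eq_decide] at p3
        have hlt : |(F'.c : ℝ) - F.c| < 1 := by
          by_cases h : c₀ ≤ F.c
          · have h' := p3.1 h
            rw [abs_of_nonneg (by linarith)] at p1 p2 q1 q2
            rw [abs_lt]; constructor <;> linarith
          · have h' : ¬ c₀ ≤ F'.c := fun h' => h (p3.2 h')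
            rw [abs_of_neg (by linarith)] at p1 p2 q1 q2
            rw [abs_lt]; constructor <;> linarith
        have : |F'.c - F.c| < 1 := by exact_mod_cast hlt
        rw [Int.abs_lt_one_iff] at this
        omega
      refine finite_and_ncard_le_of_abs_sub_le _ (fun F => F.d) ?_ (w n) (hw0 n) ?_
      · intro F hF F' hF' hd
        obtain ⟨a1, a2, -⟩ := hS F hF.1
        obtain ⟨b1, b2, -⟩ := hS F' hF'.1
        exact Cubic.ext (a1.trans b1.symm) (a2.trans b2.symm) (hceq F' hF' F hF) hd
      · intro F hF F' hF'
        obtain ⟨a1, a2, a3, a4⟩ := hS F hF.1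
        obtain ⟨b1, b2, b3, b4⟩ := hS F' hF'.1
        obtain ⟨-, p1, p2, p3, p4⟩ := hfib F hF
        obtain ⟨-, -, -, -, q4⟩ := hfib F' hF'
        have := abs_d_sub_le hy (Nat.cast_nonneg n) (a1 ▸ ha) (a1 ▸ hay) (b1.trans a1.symm)
          (b2.trans a2.symm) (hceq F hF F' hF') (by rw [← decide_eq_decide, p4, q4]) a3 b3
          (by rw [hdist F hF.1, a1]; gcongr)
        rw [a1] at this
        exact this)
  refine ⟨h1, h2.trans ?_⟩
  rw [Finset.sum_product]
  simp only [Finset.sum_const, Finset.card_univ, Fintype.card_prod, Fintype.card_bool, nsmul_eq_mul]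
  rw [← Finset.mul_sum, Finset.sum_add_distrib, Finset.sum_const, Finset.card_range, nsmul_eq_mul,
    hw, ← Finset.mul_sum]
  have h3 := sum_range_inv_mul_sqrt_le hy N
  have h4 : (N : ℝ) ≤ 4 * y ^ 2 / |(a : ℝ)| + 1 := by
    rw [hN]; push_cast
    have := Nat.floor_le (show 0 ≤ 4 * y ^ 2 / |(a : ℝ)| by positivity)
    linarith
  calc _ ≤ ((2 * 2 : ℕ) : ℝ) * (9 * y ^ 4 / (|(a : ℝ)| * √|(a : ℝ)|) * (4 / √y) +
        (4 * y ^ 2 / |(a : ℝ)| + 1) * 1) := by gcongr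
    _ = _ := by push_cast; field_simp; ring

/-- Forms with given `a ≠ 0`, whose coefficient `b` is reduced modulo `3 a`. -/
lemma finite_and_ncard_le_of_a (y : ℝ) (hy : 1 ≤ y) (a : ℤ) (ha : a ≠ 0)
    (hay : |(a : ℝ)| ≤ 16 * y) (S : Set (Cubic ℤ))
    (hS : ∀ F ∈ S, F.a = a ∧ (0 ≤ F.b ∧ F.b < |3 * a|) ∧ |(F.discr : ℝ)| ≤ y ^ 4 ∧
      |(F.b : ℝ) ^ 2 - 3 * F.a * F.c| ≤ 12 * y ^ 2) :
    S.Finite ∧ (S.ncard : ℝ) ≤ 240 * y ^ 3 + 432 * y ^ 4 / √y * (1 / √|(a : ℝ)|) := by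
  have haR : (a : ℝ) ≠ 0 := by exact_mod_cast ha
  have hA : 0 < |(a : ℝ)| := abs_pos.2 haR
  have hsA : 0 < √|(a : ℝ)| := Real.sqrt_pos.2 hA
  have hy0 : 0 < y := by linarith
  have hsy : 0 < √y := Real.sqrt_pos.2 hy0
  obtain ⟨h1, h2⟩ := finite_and_ncard_le_sum_of_fibers S (fun F => F.b)
    (Finset.Ico 0 |3 * a|) _
    (by
      intro F hF
      rw [Finset.mem_Ico]
      exact (hS F hF).2.1)
    (fun b _ => finite_and_ncard_le_of_a_b y hy a b ha hay {F ∈ S | F.b = b} (by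
      rintro F ⟨hF, hb⟩
      obtain ⟨h1, -, h2, h3⟩ := hS F hF
      exact ⟨h1, hb, h2, h3⟩))
  refine ⟨h1, h2.trans ?_⟩
  rw [Finset.sum_const, Int.card_Ico, sub_zero, nsmul_eq_mul]
  have hcard : ((|3 * a|.toNat : ℕ) : ℝ) = 3 * |(a : ℝ)| := by
    have : ((|3 * a|.toNat : ℕ) : ℤ) = |3 * a| := Int.toNat_of_nonneg (abs_nonneg _)
    have h3 : ((|3 * a|.toNat : ℕ) : ℝ) = ((|3 * a| : ℤ) : ℝ) := by exact_mod_cast this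
    rw [h3, Int.cast_abs]; push_cast
    rw [abs_mul, abs_of_pos (by norm_num : (0 : ℝ) < 3)]
  rw [hcard]
  have e : 3 * |(a : ℝ)| * (16 * y ^ 2 / |(a : ℝ)| + 4 +
      144 * y ^ 4 / (|(a : ℝ)| * √|(a : ℝ)| * √y)) =
      48 * y ^ 2 + 12 * |(a : ℝ)| + 432 * y ^ 4 / √y * (1 / √|(a : ℝ)|) := by
    field_simp; ring
  rw [e]
  have : 48 * y ^ 2 + 12 * |(a : ℝ)| ≤ 240 * y ^ 3 := by
    have h3 : y ≤ y ^ 3 := le_self_pow₀ hy (by norm_num)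
    have h4 : y ^ 2 ≤ y ^ 3 := pow_le_pow_right₀ hy (by norm_num)
    linarith
  linarith

/-- Reduced forms with `a ≠ 0`. -/
lemma finite_and_ncard_le_of_a_ne_zero (y : ℝ) (hy : 1 ≤ y) (S : Set (Cubic ℤ))
    (hS : ∀ F ∈ S, F.a ≠ 0 ∧ |(F.a : ℝ)| ≤ 16 * y ∧ (0 ≤ F.b ∧ F.b < |3 * F.a|) ∧
      |(F.discr : ℝ)| ≤ y ^ 4 ∧ |(F.b : ℝ) ^ 2 - 3 * F.a * F.c| ≤ 12 * y ^ 2) :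
    S.Finite ∧ (S.ncard : ℝ) ≤ 14592 * y ^ 4 := by
  have hy0 : 0 < y := by linarith
  have hsy : 0 < √y := Real.sqrt_pos.2 hy0
  set M := ⌊16 * y⌋₊ with hM
  have hMle : (M : ℝ) ≤ 16 * y := Nat.floor_le (by positivity)
  obtain ⟨h1, h2⟩ := finite_and_ncard_le_sum_of_fibers S (fun F => (decide (0 ≤ F.a), F.a.natAbs - 1))
    (Finset.univ ×ˢ Finset.range M)
    (fun t => 240 * y ^ 3 + 432 * y ^ 4 / √y * (1 / √((t.2 : ℝ) + 1)))
    (by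
      intro F hF
      obtain ⟨h0, h1, -⟩ := hS F hF
      simp only [Finset.mem_product, Finset.mem_range, Finset.mem_univ, true_and]
      have h2 : F.a.natAbs ≤ M := by
        rw [hM, Nat.le_floor_iff (by positivity), Nat.cast_natAbs, Int.cast_abs]
        exact h1
      omega)
    (by
      rintro ⟨σ, n⟩ ht
      simp only [Finset.mem_product, Finset.mem_range, Finset.mem_univ, true_and] at ht
      obtain ⟨a, ha, haσ⟩ : ∃ a : ℤ, |a| = n + 1 ∧ (0 ≤ a ↔ σ = true) := by
        cases σ
        · exact ⟨-(n + 1), by rw [abs_neg]; exact abs_of_nonneg (by positivity), by simp; omega⟩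
        · exact ⟨n + 1, abs_of_nonneg (by positivity), by simp; positivity⟩
      have haR : |(a : ℝ)| = n + 1 := by exact_mod_cast congrArg (fun k : ℤ => (k : ℝ)) ha
      rw [← haR]
      have hn : (n : ℝ) + 1 ≤ M := by exact_mod_cast ht
      refine finite_and_ncard_le_of_a y hy a (by rintro rfl; simp at ha; omega) (by linarith) _ ?_
      rintro F ⟨hF, hFt⟩
      simp only [Prod.mk.injEq] at hFt
      obtain ⟨h0, -, h3, h4, h5⟩ := hS F hF
      have hFa : F.a = a := by
        have h6 : (0 ≤ F.a) ↔ (0 ≤ a) := by rw [haσ, ← hFt.1, decide_eq_true_iff]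
        have h7 := hFt.2
        rw [Int.abs_eq_natAbs] at ha
        omega
      exact ⟨hFa, hFa ▸ h3, h4, h5⟩)
  refine ⟨h1, h2.trans ?_⟩
  rw [Finset.sum_product]
  simp only [Finset.sum_const, Finset.card_univ, Fintype.card_bool, nsmul_eq_mul]
  rw [Finset.sum_add_distrib, Finset.sum_const, Finset.card_range, nsmul_eq_mul, ← Finset.mul_sum]
  have h3 := sum_range_inv_sqrt_le M
  have h4 : √(M : ℝ) ≤ 4 * √y := by
    rw [show 4 * √y = √(16 * y) by
      rw [Real.sqrt_mul (by norm_num), show (16 : ℝ) = 4 ^ 2 by norm_num,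
        Real.sqrt_sq (by norm_num)]]
    exact Real.sqrt_le_sqrt hMle
  calc _ ≤ ((2 : ℕ) : ℝ) * (16 * y * (240 * y ^ 3) + 432 * y ^ 4 / √y * (2 * (4 * √y))) := by
        gcongr
        exact h3.trans (by gcongr)
    _ = _ := by push_cast; field_simp; ring

/-- Reduced forms with `a = 0`, where the discriminant is `b² (c² - 4 b d)`. -/
lemma finite_and_ncard_le_of_a_eq_zero (y : ℝ) (hy : 1 ≤ y) (S : Set (Cubic ℤ))
    (hS : ∀ F ∈ S, F.a = 0 ∧ F.discr ≠ 0 ∧ (0 ≤ F.c ∧ F.c < |2 * F.b|) ∧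
      |(F.discr : ℝ)| ≤ y ^ 4) :
    S.Finite ∧ (S.ncard : ℝ) ≤ 8 * y ^ 4 := by
  have hy0 : 0 < y := by linarith
  have hdisc : ∀ F ∈ S, F.discr = F.b ^ 2 * (F.c ^ 2 - 4 * F.b * F.d) := by
    intro F hF
    simp only [discr, (hS F hF).1]; ring
  set M := ⌊y ^ 2⌋₊ with hM
  have hMle : (M : ℝ) ≤ y ^ 2 := Nat.floor_le (by positivity)
  have hb0 : ∀ F ∈ S, F.b ≠ 0 := by
    intro F hF hb
    have := (hS F hF).2.1
    rw [hdisc F hF, hb] at this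
    simp at this
  obtain ⟨h1, h2⟩ := finite_and_ncard_le_sum_of_fibers S (fun F => (decide (0 ≤ F.b), F.b.natAbs - 1))
    (Finset.univ ×ˢ Finset.range M)
    (fun t => 2 * y ^ 2 + y ^ 4 * (1 / ((t.2 : ℝ) + 1) ^ 2))
    (by
      intro F hF
      obtain ⟨-, h0, -, h1⟩ := hS F hF
      have hb := hb0 F hF
      simp only [Finset.mem_product, Finset.mem_range, Finset.mem_univ, true_and]
      have h2 : F.b.natAbs ≤ M := by
        rw [hM, Nat.le_floor_iff (by positivity), Nat.cast_natAbs, Int.cast_abs]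
        refine le_of_pow_le_pow_left₀ (n := 2) (by norm_num) (by positivity) ?_
        rw [hdisc F hF] at h0 h1
        have h3 : (1 : ℝ) ≤ |((F.c ^ 2 - 4 * F.b * F.d : ℤ) : ℝ)| := by
          exact_mod_cast Int.one_le_abs (right_ne_zero_of_mul h0)
        push_cast at h1 h3
        rw [abs_mul, abs_pow] at h1
        nlinarith [sq_nonneg |(F.b : ℝ)|]
      omega)
    (by
      rintro ⟨σ, n⟩ ht
      simp only [Finset.mem_product, Finset.mem_range, Finset.mem_univ, true_and] at ht
      obtain ⟨b, hb, hbσ⟩ : ∃ b : ℤ, |b| = n + 1 ∧ (0 ≤ b ↔ σ = true) := by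
        cases σ
        · exact ⟨-(n + 1), by rw [abs_neg]; exact abs_of_nonneg (by positivity), by simp; omega⟩
        · exact ⟨n + 1, abs_of_nonneg (by positivity), by simp; positivity⟩
      have hbR : |(b : ℝ)| = n + 1 := by exact_mod_cast congrArg (fun k : ℤ => (k : ℝ)) hb
      have hB : 0 < |(b : ℝ)| := by rw [hbR]; positivity
      have hn : (n : ℝ) + 1 ≤ M := by exact_mod_cast ht
      have hFb : ∀ F ∈ {F ∈ S | (decide (0 ≤ F.b), F.b.natAbs - 1) = (σ, n)}, F.b = b := by
        rintro F ⟨hF, hFt⟩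
        simp only [Prod.mk.injEq] at hFt
        have h0 := hb0 F hF
        have h6 : (0 ≤ F.b) ↔ (0 ≤ b) := by rw [hbσ, ← hFt.1, decide_eq_true_iff]
        have h7 := hFt.2
        rw [Int.abs_eq_natAbs] at hb
        omega
      obtain ⟨h3, h4⟩ := finite_and_ncard_le_sum_of_fibers
        {F ∈ S | (decide (0 ≤ F.b), F.b.natAbs - 1) = (σ, n)} (fun F => F.c)
        (Finset.Ico 0 |2 * b|) (fun _ => y ^ 4 / (2 * |(b : ℝ)| ^ 3) + 1)
        (by
          intro F hF
          rw [Finset.mem_Ico, ← hFb F hF]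
          exact (hS F hF.1).2.2.1)
        (by
          intro c _
          refine finite_and_ncard_le_of_abs_sub_le _ (fun F => F.d) ?_ _ (by positivity) ?_
          · rintro F ⟨hF, hc⟩ F' ⟨hF', hc'⟩ hd
            exact Cubic.ext ((hS F hF.1).1.trans (hS F' hF'.1).1.symm)
              ((hFb F hF).trans (hFb F' hF').symm) (hc.trans hc'.symm) hd
          · rintro F ⟨hF, hc⟩ F' ⟨hF', hc'⟩
            have d1 := (hS F hF.1).2.2.2
            have d2 := (hS F' hF'.1).2.2.2
            rw [hdisc F hF.1, hFb F hF, hc] at d1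
            rw [hdisc F' hF'.1, hFb F' hF', hc'] at d2
            rw [le_div_iff₀ (by positivity)]
            have d3 : |(b : ℝ) ^ 2 * (c ^ 2 - 4 * b * F.d) - b ^ 2 * (c ^ 2 - 4 * b * F'.d)| ≤
                y ^ 4 + y ^ 4 := by
              push_cast at d1 d2
              exact (abs_sub _ _).trans (add_le_add d1 d2)
            rw [show (b : ℝ) ^ 2 * (c ^ 2 - 4 * b * F.d) - b ^ 2 * (c ^ 2 - 4 * b * F'.d) =
              -(4 * b ^ 3 * (F.d - F'.d)) by ring, abs_neg, abs_mul, abs_mul, abs_pow,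
              abs_of_pos (by norm_num : (0 : ℝ) < 4)] at d3
            linarith)
      refine ⟨h3, h4.trans ?_⟩
      rw [Finset.sum_const, Int.card_Ico, sub_zero, nsmul_eq_mul]
      have hcard : ((|2 * b|.toNat : ℕ) : ℝ) = 2 * |(b : ℝ)| := by
        have : ((|2 * b|.toNat : ℕ) : ℤ) = |2 * b| := Int.toNat_of_nonneg (abs_nonneg _)
        have h3 : ((|2 * b|.toNat : ℕ) : ℝ) = ((|2 * b| : ℤ) : ℝ) := by exact_mod_cast this
        rw [h3, Int.cast_abs]; push_cast
        rw [abs_mul, abs_of_pos (by norm_num : (0 : ℝ) < 2)]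
      rw [hcard]
      simp only
      rw [← hbR]
      have e : 2 * |(b : ℝ)| * (y ^ 4 / (2 * |(b : ℝ)| ^ 3) + 1) =
          2 * |(b : ℝ)| + y ^ 4 * (1 / |(b : ℝ)| ^ 2) := by field_simp; ring
      rw [e]
      linarith)
  refine ⟨h1, h2.trans ?_⟩
  rw [Finset.sum_product]
  simp only [Finset.sum_const, Finset.card_univ, Fintype.card_bool, nsmul_eq_mul]
  rw [Finset.sum_add_distrib, Finset.sum_const, Finset.card_range, nsmul_eq_mul, ← Finset.mul_sum]
  have h3 := sum_range_inv_sq_le M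
  calc _ ≤ ((2 : ℕ) : ℝ) * (y ^ 2 * (2 * y ^ 2) + y ^ 4 * 2) := by gcongr
    _ = _ := by push_cast; ring

/-- Reduced forms of non-zero discriminant at most `y⁴` in absolute value: the leading coefficients
of the form and of its Hessian are of the size that the minimum of a reduced form has, and a
translation has been used to reduce `b` modulo `3 a`, or `c` modulo `2 b` if `a = 0`. Several reduced
forms may be equivalent to each other. -/
def reducedForms (y : ℝ) : Set (Cubic ℤ) :=
  {F | F.discr ≠ 0 ∧ |(F.discr : ℝ)| ≤ y ^ 4 ∧ |(F.a : ℝ)| ≤ 16 * y ∧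
    |(F.b : ℝ) ^ 2 - 3 * F.a * F.c| ≤ 12 * y ^ 2 ∧ (F.a ≠ 0 → 0 ≤ F.b ∧ F.b < |3 * F.a|) ∧
    (F.a = 0 → 0 ≤ F.c ∧ F.c < |2 * F.b|)}

lemma finite_reducedForms_and_ncard_le {y : ℝ} (hy : 1 ≤ y) :
    (reducedForms y).Finite ∧ ((reducedForms y).ncard : ℝ) ≤ 14600 * y ^ 4 := by
  obtain ⟨h1, h2⟩ := finite_and_ncard_le_of_a_ne_zero y hy {F ∈ reducedForms y | F.a ≠ 0} (by
    rintro F ⟨⟨-, h1, h2, h3, h4, -⟩, ha⟩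
    exact ⟨ha, h2, h4 ha, h1, h3⟩)
  obtain ⟨h3, h4⟩ := finite_and_ncard_le_of_a_eq_zero y hy {F ∈ reducedForms y | F.a = 0} (by
    rintro F ⟨⟨h0, h1, -, -, -, h4⟩, ha⟩
    exact ⟨ha, h0, h4 ha, h1⟩)
  have hun : reducedForms y = {F ∈ reducedForms y | F.a ≠ 0} ∪ {F ∈ reducedForms y | F.a = 0} := by
    ext F
    simp only [Set.mem_union, Set.mem_ofPred_eq, ← and_or_left]
    exact ⟨fun h => ⟨h, (eq_or_ne F.a 0).symm⟩, fun h => h.1⟩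
  have h5 : ((reducedForms y).ncard : ℝ) ≤ ({F ∈ reducedForms y | F.a ≠ 0}.ncard : ℝ) +
      ({F ∈ reducedForms y | F.a = 0}.ncard : ℝ) := by
    conv_lhs => rw [hun]
    exact_mod_cast Set.ncard_union_le _ _
  refine ⟨by rw [hun]; exact h1.union h3, by linarith⟩

/-- Every dominated form of non-zero discriminant is properly equivalent to a reduced form. -/
lemma IsDominated.exists_reduced {F : Cubic ℤ} (hF : F.IsDominated) (h0 : F.discr ≠ 0) {y : ℝ}
    (hy : 0 ≤ y) (hD : |(F.discr : ℝ)| ≤ y ^ 4) : ∃ G ∈ reducedForms y, F.Equivalent G := by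
  obtain ⟨-, G, hFG, h1, h2⟩ := hF.exists_equivalent h0
  have hroot : |(F.discr : ℝ)| ^ (1 / 4 : ℝ) ≤ y := by
    calc |(F.discr : ℝ)| ^ (1 / 4 : ℝ) ≤ (y ^ 4) ^ (1 / 4 : ℝ) :=
          Real.rpow_le_rpow (abs_nonneg _) hD (by norm_num)
      _ = y := by rw [← Real.rpow_natCast, ← Real.rpow_mul hy]; norm_num
  have hroot0 : 0 ≤ |(F.discr : ℝ)| ^ (1 / 4 : ℝ) := by positivity
  have hGa : |(G.a : ℝ)| ≤ 16 * y := h1.trans (by linarith)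
  have hGh : |(G.b : ℝ) ^ 2 - 3 * G.a * G.c| ≤ 12 * y ^ 2 := h2.trans (by gcongr)
  -- A translation `X ↦ X + k Y` preserves the leading coefficients of the form and of its Hessian.
  have htrans : ∀ k : ℤ, F.Equivalent (G.subst 1 k 0 1) := fun k =>
    hFG.trans ⟨1, k, 0, 1, by ring, rfl⟩
  have ea : ∀ k, (G.subst 1 k 0 1).a = G.a := fun k => by simp [Cubic.subst]
  have eb : ∀ k, (G.subst 1 k 0 1).b = G.b + 3 * G.a * k := fun k => by
    simp [Cubic.subst]; ring
  have ec : ∀ k, (G.subst 1 k 0 1).c = G.c + 2 * G.b * k + 3 * G.a * k ^ 2 := fun k => by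
    simp [Cubic.subst]; ring
  have eh : ∀ k, |((G.subst 1 k 0 1).b : ℝ) ^ 2 -
      3 * (G.subst 1 k 0 1).a * (G.subst 1 k 0 1).c| ≤ 12 * y ^ 2 := fun k => by
    rw [ea, eb, ec]
    refine le_trans (le_of_eq ?_) hGh
    congr 1
    push_cast
    ring
  have hred : ∀ k, (G.a ≠ 0 → 0 ≤ (G.subst 1 k 0 1).b ∧ (G.subst 1 k 0 1).b < |3 * G.a|) →
      (G.a = 0 → 0 ≤ (G.subst 1 k 0 1).c ∧ (G.subst 1 k 0 1).c < |2 * (G.subst 1 k 0 1).b|) →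
      ∃ G ∈ reducedForms y, F.Equivalent G := by
    intro k k1 k2
    refine ⟨G.subst 1 k 0 1, ⟨?_, ?_, ?_, eh k, ?_, ?_⟩, htrans k⟩
    · rw [(htrans k).discr_eq]; exact h0
    · rw [(htrans k).discr_eq]; exact hD
    · rw [ea]; exact hGa
    · rw [ea]; exact k1
    · rw [ea]; exact k2
  by_cases ha : G.a = 0
  · have hb : G.b ≠ 0 := by
      intro hb
      have := hFG.discr_eq
      rw [discr, ha, hb] at this
      simp at this
      exact h0 this.symm
    refine hred (-(G.c / (2 * G.b))) (fun h => absurd ha h) fun _ => ?_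
    have e : (G.subst 1 (-(G.c / (2 * G.b))) 0 1).c = G.c % (2 * G.b) := by
      rw [ec, ha, Int.emod_def]; ring
    have e' : (G.subst 1 (-(G.c / (2 * G.b))) 0 1).b = G.b := by rw [eb, ha]; ring
    rw [e, e']
    have h2b : 2 * G.b ≠ 0 := by simpa using hb
    exact ⟨Int.emod_nonneg _ h2b, Int.emod_lt_abs _ h2b⟩
  · refine hred (-(G.b / (3 * G.a))) (fun _ => ?_) fun h => absurd h ha
    have e : (G.subst 1 (-(G.b / (3 * G.a))) 0 1).b = G.b % (3 * G.a) := by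
      rw [eb, Int.emod_def]; ring
    rw [e]
    have h3a : 3 * G.a ≠ 0 := by simpa using ha
    exact ⟨Int.emod_nonneg _ h3a, Int.emod_lt_abs _ h3a⟩

end Cubic

/-! ### The number of dominated cubics -/

namespace Cubic

/-- The dominated cubics of height at most `H` with discriminant in `[m, D]` in absolute value, and
of root spread at least `1 / R`: the number of reduced forms times the number of cubics in one
class. -/
lemma finite_and_ncard_le_of_discr_mem {H D R m : ℝ} (hH : 1 ≤ H) (hR : 0 < R) (hm : 0 < m)
    (hD : 1 ≤ D) (S : Set (Cubic ℤ))
    (hS : ∀ F ∈ S, F.IsDominated ∧ |(F.a : ℝ)| ≤ H ∧ F.discr ≠ 0 ∧ m ≤ |(F.discr : ℝ)| ∧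
      |(F.discr : ℝ)| ≤ D ∧ R⁻¹ ≤ rootSpread F.toPoly) :
    S.Finite ∧ (S.ncard : ℝ) ≤ 43800 * D * (Real.logb 2 (4 * H) + 1) *
      (2 + 36 * min (2 * R) ((2 * H) ^ (2 / 3 : ℝ) * m ^ (-1 / 6 : ℝ))) := by
  set y := D ^ (1 / 4 : ℝ) with hy
  have hy1 : 1 ≤ y := Real.one_le_rpow hD (by norm_num)
  have hy4 : y ^ 4 = D := by
    rw [hy, ← Real.rpow_natCast, ← Real.rpow_mul (by linarith)]; norm_num
  have hlog : 0 ≤ Real.logb 2 (4 * H) := Real.logb_nonneg (by norm_num) (by linarith)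
  have hred : ∀ F ∈ S, ∃ G ∈ reducedForms y, F.Equivalent G := fun F hF =>
    (hS F hF).1.exists_reduced (hS F hF).2.2.1 (by linarith) (by rw [hy4]; exact (hS F hF).2.2.2.2.1)
  choose! f hf hFf using hred
  obtain ⟨hfin, hcard⟩ := finite_reducedForms_and_ncard_le hy1
  set B := 3 * (Real.logb 2 (4 * H) + 1) *
    (2 + 36 * min (2 * R) ((2 * H) ^ (2 / 3 : ℝ) * m ^ (-1 / 6 : ℝ))) with hB
  have hmin : 0 ≤ min (2 * R) ((2 * H) ^ (2 / 3 : ℝ) * m ^ (-1 / 6 : ℝ)) :=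
    le_min (by positivity) (by positivity)
  have hB0 : 0 ≤ B := by positivity
  obtain ⟨h1, h2⟩ := finite_and_ncard_le_sum_of_fibers S f hfin.toFinset (fun _ => B)
    (fun F hF => hfin.mem_toFinset.2 (hf F hF))
    (by
      intro G _
      rcases Set.eq_empty_or_nonempty {F ∈ S | f F = G} with he | ⟨F₀, hF₀, rfl⟩
      · rw [he]; simpa using hB0
      obtain ⟨hdom, -, h0, hm₀, -⟩ := hS F₀ hF₀
      obtain ⟨⟨α₁, β₁, α₂, β₂, s, hfac⟩, -⟩ := hdom.exists_equivalent h0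
      have hmF := hfac.norm_sq
      obtain ⟨p, q, r, t, hdet, hG⟩ := hFf F₀ hF₀
      have hfacG := hfac.subst hdet
      rw [← hG] at hfacG
      obtain ⟨h3, h4⟩ := hfacG.finite_and_ncard_le {F ∈ S | f F = f F₀} hH hR (by
        rintro F ⟨hF, hFG⟩
        obtain ⟨k1, k2, -, -, -, k3⟩ := hS F hF
        exact ⟨by rw [← hFG]; exact (hFf F hF).symm, k1, k2, k3⟩)
      refine ⟨h3, h4.trans ?_⟩
      have hs : ‖s‖ ^ (-1 / 3 : ℝ) ≤ m ^ (-1 / 6 : ℝ) := by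
        have : ‖s‖ ^ (-1 / 3 : ℝ) = (‖s‖ ^ 2) ^ (-1 / 6 : ℝ) := by
          rw [← Real.rpow_natCast, ← Real.rpow_mul (norm_nonneg _)]; norm_num
        rw [this, hmF]
        exact Real.rpow_le_rpow_of_nonpos hm hm₀ (by norm_num)
      rw [hB]
      gcongr)
  refine ⟨h1, h2.trans ?_⟩
  rw [Finset.sum_const, nsmul_eq_mul, ← Set.ncard_eq_toFinset_card _ hfin]
  rw [hy4] at hcard
  calc _ ≤ 14600 * D * B := by gcongr
    _ = _ := by rw [hB]; ring

/-- The bound that does not involve the root spread. The discriminants in `(D / 64, D]` contribute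
`O((1 + log H) (D + H^(2/3) D^(5/6)))`, and these contributions decrease geometrically as `D` is
divided by `64`. -/
lemma finite_and_ncard_le_of_discr_le {H R : ℝ} (hH : 1 ≤ H) (hR : 0 < R) (k : ℕ) :
    ∀ (D : ℝ) (S : Set (Cubic ℤ)), 0 < D → D < 64 ^ k →
    (∀ F ∈ S, F.IsDominated ∧ |(F.a : ℝ)| ≤ H ∧ F.discr ≠ 0 ∧ |(F.discr : ℝ)| ≤ D ∧
      R⁻¹ ≤ rootSpread F.toPoly) →
    S.Finite ∧ (S.ncard : ℝ) ≤ 12614400 * (Real.logb 2 (4 * H) + 1) *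
      (D + H ^ (2 / 3 : ℝ) * D ^ (5 / 6 : ℝ)) := by
  have hlog : 0 ≤ Real.logb 2 (4 * H) := Real.logb_nonneg (by norm_num) (by linarith)
  have small : ∀ (D : ℝ) (S : Set (Cubic ℤ)), 0 < D → D < 1 →
      (∀ F ∈ S, F.discr ≠ 0 ∧ |(F.discr : ℝ)| ≤ D) →
      S.Finite ∧ (S.ncard : ℝ) ≤ 12614400 * (Real.logb 2 (4 * H) + 1) *
        (D + H ^ (2 / 3 : ℝ) * D ^ (5 / 6 : ℝ)) := by
    intro D S hD hD1 hS
    have : S = ∅ := by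
      rw [Set.eq_empty_iff_forall_notMem]
      intro F hF
      obtain ⟨h0, h1⟩ := hS F hF
      have : (1 : ℝ) ≤ |(F.discr : ℝ)| := by exact_mod_cast Int.one_le_abs h0
      linarith
    rw [this]
    simp only [Set.finite_empty, Set.ncard_empty, Nat.cast_zero, true_and]
    positivity
  induction k with
  | zero =>
    intro D S hD hD1 hS
    exact small D S hD (by simpa using hD1) fun F hF => ⟨(hS F hF).2.2.1, (hS F hF).2.2.2.1⟩
  | succ k ih =>
    intro D S hD hDk hS
    rcases lt_or_ge D 1 with hD1 | hD1
    · exact small D S hD hD1 fun F hF => ⟨(hS F hF).2.2.1, (hS F hF).2.2.2.1⟩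
    have hH0 : 0 < H := by linarith
    obtain ⟨h1, h2⟩ := ih (D / 64) {F ∈ S | |(F.discr : ℝ)| ≤ D / 64} (by positivity)
      (by rw [pow_succ] at hDk; linarith)
      (by
        rintro F ⟨hF, hFD⟩
        obtain ⟨k1, k2, k3, -, k4⟩ := hS F hF
        exact ⟨k1, k2, k3, hFD, k4⟩)
    obtain ⟨h3, h4⟩ := finite_and_ncard_le_of_discr_mem (m := D / 64) hH hR (by positivity) hD1
      {F ∈ S | ¬ |(F.discr : ℝ)| ≤ D / 64}
      (by
        rintro F ⟨hF, hFD⟩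
        obtain ⟨k1, k2, k3, k5, k4⟩ := hS F hF
        exact ⟨k1, k2, k3, (not_le.1 hFD).le, k5, k4⟩)
    have hun : S = {F ∈ S | |(F.discr : ℝ)| ≤ D / 64} ∪ {F ∈ S | ¬ |(F.discr : ℝ)| ≤ D / 64} := by
      ext F
      simp only [Set.mem_union, Set.mem_ofPred_eq, ← and_or_left]
      exact ⟨fun h => ⟨h, em _⟩, fun h => h.1⟩
    have h5 : (S.ncard : ℝ) ≤ ({F ∈ S | |(F.discr : ℝ)| ≤ D / 64}.ncard : ℝ) +
        ({F ∈ S | ¬ |(F.discr : ℝ)| ≤ D / 64}.ncard : ℝ) := by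
      conv_lhs => rw [hun]
      exact_mod_cast Set.ncard_union_le _ _
    refine ⟨by rw [hun]; exact h1.union h3, ?_⟩
    have e1 : (D / 64) ^ (5 / 6 : ℝ) = D ^ (5 / 6 : ℝ) / 32 := by
      rw [Real.div_rpow hD.le (by norm_num), show (64 : ℝ) = 2 ^ (6 : ℝ) by norm_num,
        ← Real.rpow_mul (by norm_num)]
      norm_num
    have e2 : D * (D / 64) ^ (-1 / 6 : ℝ) = 2 * D ^ (5 / 6 : ℝ) := by
      have h64 : (64 : ℝ) ^ (-1 / 6 : ℝ) = 1 / 2 := by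
        rw [show (64 : ℝ) = 2 ^ (6 : ℝ) by norm_num, ← Real.rpow_mul (by norm_num)]
        norm_num
      rw [Real.div_rpow hD.le (by norm_num), h64]
      nth_rewrite 1 [← Real.rpow_one D]
      rw [← mul_div_assoc, ← Real.rpow_add hD]
      norm_num
      ring
    have e3 : (2 * H) ^ (2 / 3 : ℝ) ≤ 2 * H ^ (2 / 3 : ℝ) := by
      rw [Real.mul_rpow (by norm_num) hH0.le]
      gcongr
      calc (2 : ℝ) ^ (2 / 3 : ℝ) ≤ 2 ^ (1 : ℝ) :=
            Real.rpow_le_rpow_of_exponent_le (by norm_num) (by norm_num)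
        _ = 2 := Real.rpow_one 2
    set Λ := Real.logb 2 (4 * H) + 1
    set E := H ^ (2 / 3 : ℝ) * D ^ (5 / 6 : ℝ) with hE
    have hE0 : 0 ≤ E := by positivity
    have h6 : ({F ∈ S | ¬ |(F.discr : ℝ)| ≤ D / 64}.ncard : ℝ) ≤ 43800 * Λ * (2 * D + 144 * E) := by
      refine h4.trans ?_
      calc 43800 * D * Λ * (2 + 36 * min (2 * R) ((2 * H) ^ (2 / 3 : ℝ) * (D / 64) ^ (-1 / 6 : ℝ)))
          ≤ 43800 * D * Λ * (2 + 36 * (2 * H ^ (2 / 3 : ℝ) * (D / 64) ^ (-1 / 6 : ℝ))) := by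
            gcongr
            exact (min_le_right _ _).trans (by gcongr)
        _ = 43800 * Λ * (2 * D + 72 * H ^ (2 / 3 : ℝ) * (D * (D / 64) ^ (-1 / 6 : ℝ))) := by ring
        _ = _ := by rw [e2, hE]; ring
    rw [e1] at h2
    have h7 : 12614400 * Λ * (D / 64 + H ^ (2 / 3 : ℝ) * (D ^ (5 / 6 : ℝ) / 32)) =
        12614400 * Λ * (D / 64 + E / 32) := by rw [hE]; ring
    rw [h7] at h2
    have hΛ : 0 ≤ Λ := by positivity
    nlinarith [mul_nonneg hΛ hD.le, mul_nonneg hΛ hE0]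

/-- The root spread of a dominated cubic is at most `4`. -/
lemma IsDominated.rootSpread_le {F : Cubic ℤ} (hF : F.IsDominated) (h0 : F.discr ≠ 0) :
    rootSpread F.toPoly ≤ 4 := by
  obtain ⟨⟨α₁, β₁, α₂, β₂, s, hfac⟩, -⟩ := hF.exists_equivalent h0
  obtain ⟨h1, h2, h3⟩ := hfac.norm_le hF
  exact le_of_mul_le_mul_right (hfac.rootSpread_mul_le hF.ne_zero h1 h2 h3)
    (abs_pos.2 (by exact_mod_cast hF.ne_zero))

/-- The two bounds combined. For `H < 2` the factor `log H` may vanish, and the first bound is at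
most a multiple of `D`. -/
lemma exists_ncard_le (ε : ℝ) (hε : 0 < ε) :
    ∃ c : ℝ, 0 < c ∧ ∀ H D R : ℝ, 1 ≤ H → 0 < D → 0 < R → ∀ S : Set (Cubic ℤ),
      (∀ F ∈ S, F.IsDominated ∧ |(F.a : ℝ)| ≤ H ∧ F.discr ≠ 0 ∧ |(F.discr : ℝ)| ≤ D ∧
        R⁻¹ ≤ rootSpread F.toPoly) →
      S.Finite ∧ (S.ncard : ℝ) ≤
        c * (min (H ^ (2 / 3 + ε) * D ^ (5 / 6 : ℝ)) (Real.log H * (D * R)) + H ^ ε * D) := by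
  have hl2 : 1 / 2 < Real.log 2 := by linarith [Real.log_two_gt_d9]
  set C := 3 + 1 / (ε * Real.log 2) with hC
  have hC0 : 0 < C := by positivity
  refine ⟨12614400 * C + 28032000 + 12 * 12614400, by positivity, ?_⟩
  intro H D R hH hD hR S hS
  obtain ⟨k, hk⟩ := pow_unbounded_of_one_lt D (show (1 : ℝ) < 64 by norm_num)
  obtain ⟨hfin, hA⟩ := finite_and_ncard_le_of_discr_le hH hR k D S hD hk hS
  refine ⟨hfin, ?_⟩
  have hH0 : 0 < H := by linarith
  have hlogH : 0 ≤ Real.log H := Real.log_nonneg hH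
  have hHε : 1 ≤ H ^ ε := Real.one_le_rpow hH hε.le
  have hrhs : 0 ≤ min (H ^ (2 / 3 + ε) * D ^ (5 / 6 : ℝ)) (Real.log H * (D * R)) :=
    le_min (by positivity) (by positivity)
  rcases S.eq_empty_or_nonempty with rfl | ⟨F₀, hF₀⟩
  · rw [Set.ncard_empty, Nat.cast_zero]
    positivity
  obtain ⟨hdom, -, h0, hD0, hspread⟩ := hS F₀ hF₀
  have hD1 : 1 ≤ D := by
    have : (1 : ℝ) ≤ |(F₀.discr : ℝ)| := by exact_mod_cast Int.one_le_abs h0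
    linarith
  have hR4 : 1 ≤ 4 * R := by
    have := hspread.trans (hdom.rootSpread_le h0)
    rwa [inv_le_iff_one_le_mul₀ hR] at this
  obtain ⟨-, hB⟩ := finite_and_ncard_le_of_discr_mem (m := 1) hH hR one_pos hD1 S (by
    intro F hF
    obtain ⟨k1, k2, k3, k4, k5⟩ := hS F hF
    exact ⟨k1, k2, k3, by exact_mod_cast Int.one_le_abs k3, k4, k5⟩)
  have hΛ : Real.logb 2 (4 * H) + 1 = 3 + Real.log H / Real.log 2 := by
    rw [Real.logb_mul (by norm_num) hH0.ne', show (4 : ℝ) = 2 ^ (2 : ℝ) by norm_num,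
      Real.logb_rpow (by norm_num) (by norm_num), Real.logb]
    ring
  rw [hΛ] at hA hB
  have hΛε : 3 + Real.log H / Real.log 2 ≤ C * H ^ ε := by
    have h1 := Real.log_le_rpow_div hH0.le hε
    have h2 : Real.log H / Real.log 2 ≤ H ^ ε / ε / Real.log 2 := by gcongr
    have h3 : H ^ ε / ε / Real.log 2 = 1 / (ε * Real.log 2) * H ^ ε := by field_simp
    rw [hC, add_mul]
    linarith
  have hDε : D ≤ H ^ ε * D := le_mul_of_one_le_left hD.le hHε
  rcases min_choice (H ^ (2 / 3 + ε) * D ^ (5 / 6 : ℝ)) (Real.log H * (D * R)) with hmin | hmin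
  · rw [hmin]
    have h1 : 0 ≤ H ^ (2 / 3 + ε) * D ^ (5 / 6 : ℝ) + H ^ ε * D := by positivity
    calc (S.ncard : ℝ) ≤ 12614400 * (C * H ^ ε) * (D + H ^ (2 / 3 : ℝ) * D ^ (5 / 6 : ℝ)) := by
          refine hA.trans ?_
          gcongr
      _ = 12614400 * C * (H ^ (2 / 3 + ε) * D ^ (5 / 6 : ℝ) + H ^ ε * D) := by
          rw [Real.rpow_add hH0]; ring
      _ ≤ _ := by
          refine mul_le_mul_of_nonneg_right ?_ h1
          linarith
  · rw [hmin]
    have hX : 0 ≤ Real.log H * (D * R) := by positivity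
    have hY : 0 ≤ H ^ ε * D := by positivity
    rcases lt_or_ge H 2 with hH2 | hH2
    · have h1 : Real.log H / Real.log 2 ≤ 1 := by
        rw [div_le_one (by linarith)]
        exact Real.log_le_log hH0 hH2.le
      have h2 : H ^ (2 / 3 : ℝ) ≤ 2 := by
        calc H ^ (2 / 3 : ℝ) ≤ H ^ (1 : ℝ) :=
              Real.rpow_le_rpow_of_exponent_le hH (by norm_num)
          _ ≤ 2 := by rw [Real.rpow_one]; exact hH2.le
      have h3 : D ^ (5 / 6 : ℝ) ≤ D := by
        calc D ^ (5 / 6 : ℝ) ≤ D ^ (1 : ℝ) :=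
              Real.rpow_le_rpow_of_exponent_le hD1 (by norm_num)
          _ = D := Real.rpow_one D
      calc (S.ncard : ℝ) ≤ 12614400 * (3 + 1) * (D + 2 * D) := by
            refine hA.trans ?_
            gcongr
        _ = 12 * 12614400 * D := by ring
        _ ≤ 12 * 12614400 * (Real.log H * (D * R) + H ^ ε * D) := by
            gcongr
            linarith
        _ ≤ _ := by
            refine mul_le_mul_of_nonneg_right ?_ (by positivity)
            linarith [mul_pos (show (0 : ℝ) < 12614400 by norm_num) hC0]
    · have h1 : 3 + Real.log H / Real.log 2 ≤ 8 * Real.log H := by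
        have h2 : Real.log 2 ≤ Real.log H := Real.log_le_log (by norm_num) hH2
        have h3 : 1 ≤ Real.log H / Real.log 2 := by rwa [one_le_div (by linarith)]
        have h4 : Real.log H / Real.log 2 ≤ 2 * Real.log H := by
          rw [div_le_iff₀ (by linarith)]
          nlinarith
        linarith
      calc (S.ncard : ℝ) ≤ 43800 * D * (8 * Real.log H) * (8 * R + 36 * (2 * R)) := by
            refine hB.trans ?_
            have h5 : min (2 * R) ((2 * H) ^ (2 / 3 : ℝ) * 1 ^ (-1 / 6 : ℝ)) ≤ 2 * R :=
              min_le_left _ _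
            have h6 : 0 ≤ min (2 * R) ((2 * H) ^ (2 / 3 : ℝ) * 1 ^ (-1 / 6 : ℝ)) :=
              le_min (by positivity) (by positivity)
            gcongr
            linarith
        _ = 28032000 * (Real.log H * (D * R)) := by ring
        _ ≤ 28032000 * (Real.log H * (D * R) + H ^ ε * D) := by
            gcongr
            linarith
        _ ≤ _ := by
            refine mul_le_mul_of_nonneg_right ?_ (by positivity)
            linarith [mul_pos (show (0 : ℝ) < 12614400 by norm_num) hC0]

end Cubic

/-- The polynomials to be counted are dominated cubics. -/
lemma exists_isDominated_of_mem {H D R : ℝ} {P : ℤ[X]} (hP : P ∈ cubicsOfBoundedDiscr H D R) :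
    ∃ F : Cubic ℤ, (F.IsDominated ∧ |(F.a : ℝ)| ≤ H ∧ F.discr ≠ 0 ∧ |(F.discr : ℝ)| ≤ D ∧
      R⁻¹ ≤ rootSpread F.toPoly) ∧ F.toPoly = P := by
  obtain ⟨hdeg, hlead, hle, h0, hD, hr⟩ := hP
  have hdeg' : P.degree = 3 :=
    (Polynomial.degree_eq_iff_natDegree_eq_of_pos (by norm_num)).2 hdeg
  set F : Cubic ℤ := ⟨P.coeff 3, P.coeff 2, P.coeff 1, P.coeff 0⟩ with hF
  have hFP : F.toPoly = P := by
    have := P.as_sum_range_C_mul_X_pow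
    rw [hdeg] at this
    rw [this]
    simp [Cubic.toPoly, hF, Finset.sum_range_succ]
    ring
  have hdiscr : F.discr = P.discr := by
    rw [Polynomial.discr_of_degree_eq_three hdeg']
    rfl
  have hlc : P.leadingCoeff = F.a := by rw [Polynomial.leadingCoeff, hdeg]
  rw [hlc] at hlead
  have hcoeff : ∀ i, |P.coeff i| ≤ |F.a| := by
    intro i
    have h1 := P.le_supNorm i
    rw [← hlead, Int.norm_eq_abs] at h1
    exact_mod_cast h1
  refine ⟨F, ⟨⟨?_, hcoeff 2, hcoeff 1, hcoeff 0⟩, hlead.le.trans hle, ?_, ?_, ?_⟩, hFP⟩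
  · rw [← hlc, Ne, Polynomial.leadingCoeff_eq_zero]
    rintro rfl
    simp at hdeg
  · rw [hdiscr]
    rintro h
    rw [h] at h0
    simp at h0
  · rw [hdiscr]; exact hD
  · rw [hFP]; exact hr

theorem theorem3 (ε : ℝ) (hε : 0 < ε) :
    ∃ c : ℝ, 0 < c ∧ ∀ H D R : ℝ, 1 ≤ H → 0 < D → 0 < R →
      (cubicsOfBoundedDiscr H D R).Finite ∧
      ((cubicsOfBoundedDiscr H D R).ncard : ℝ) ≤
        c * (min (H ^ (2 / 3 + ε) * D ^ (5 / 6 : ℝ)) (Real.log H * (D * R)) + H ^ ε * D) := by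
  obtain ⟨c, hc, h⟩ := Cubic.exists_ncard_le ε hε
  refine ⟨c, hc, fun H D R hH hD hR => ?_⟩
  obtain ⟨h1, h2⟩ := h H D R hH hD hR {F | F.IsDominated ∧ |(F.a : ℝ)| ≤ H ∧ F.discr ≠ 0 ∧
    |(F.discr : ℝ)| ≤ D ∧ R⁻¹ ≤ rootSpread F.toPoly} fun F hF => hF
  have hsub : cubicsOfBoundedDiscr H D R ⊆ Cubic.toPoly '' {F : Cubic ℤ | F.IsDominated ∧
      |(F.a : ℝ)| ≤ H ∧ F.discr ≠ 0 ∧ |(F.discr : ℝ)| ≤ D ∧ R⁻¹ ≤ rootSpread F.toPoly} :=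
    fun P hP => exists_isDominated_of_mem hP
  refine ⟨(h1.image _).subset hsub, le_trans ?_ h2⟩
  exact_mod_cast (Set.ncard_le_ncard hsub (h1.image _)).trans (Set.ncard_image_le h1)
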